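/- Let $P_0,\dots,P_n$ be a trajectory, i.e. points $P_i=(x_i,y_i,t_i)\in\mathbb R^3$ with $t_0<t_1<\dots<t_n$. Let $s+k\le n$, $\varepsilon>0$, $t_c>t_s$ and $m\ge 3$. For $1\le i\le k$ put $c_i=\frac{t_c-t_s}{t_{s+i}-t_s}$ and let $\mathcal R_{s+i}\subset\mathbb R^2$ be the regular $m$-gon (closed region) with vertices $$v_j=\bigl(x_s+c_i(x_{s+i}-x_s),\;y_s+c_i(y_{s+i}-y_s)\bigr)+c_i\varepsilon\Bigl(\cos\tfrac{2\pi(j-1)}m,\;\sin\tfrac{2\pi(j-1)}m\Bigr),\qquad 1\le j\le m .$$ This is the inscribed regular $m$-gon of the circle in the plane $t=t_c$ that is the projection from $P_s$ of the circle of radius $\varepsilon$ around $P_{s+i}$ in the plane $t=t_{s+i}$. Let $\mathcal R^*_l=\bigcap_{i=1}^{l}\mathcal R_{s+i}$. A convex polygon (possibly empty, a point or a segment) is represented by the list of its vertices in counterclockwise order. **Proposition.** For fixed $m$, the intersection of $\mathcal R^*_l$ and $\mathcal R_{s+l+1}$ ($1\le l<k$) can be computed in $O(1)$ time. More precisely,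 in the real RAM model (unit-cost exact arithmetic and comparisons of reals, integer counters and indices, arrays) there is a single program such that for every $m\ge 3$ there is a constant $C=C(m)$ with the following property: for every trajectory and all $s,k,\varepsilon,t_c$ as above and all $1\le l<k$, given vertex lists of $\mathcal R^*_l$ and of $\mathcal R_{s+l+1}$, the program halts after at most $C$ steps with a vertex list of $\mathcal R^*_l\cap\mathcal R_{s+l+1}$ as its output. -/

import Mathlib

/-! ### Real RAM

The usual model of computational geometry: integer variables, real variables and real arrays
addressed by integers; exact field operations and comparisons of reals, addition, truncated
subtraction and comparison of natural numbers, each in one time step. There is no rounding and no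
conversion of reals to integers. -/

namespace RealRAM

/-- A memory state. Variables and arrays are named by natural numbers. -/
structure State where
  int : ℕ → ℕ
  real : ℕ → ℝ
  arr : ℕ → ℕ → ℝ

/-- Expressions with natural number values (used as counters and array indices). -/
inductive IExpr where
  | const (c : ℕ)
  | var (x : ℕ)
  | add (e f : IExpr)
  | sub (e f : IExpr)

def IExpr.eval (σ : State) : IExpr → ℕ
  | const c => c
  | var x => σ.int x
  | add e f => e.eval σ + f.eval σ
  | sub e f => e.eval σ - f.eval σ

/-- One time step for each constant, variable access and operation. -/
def IExpr.cost : IExpr → ℕ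
  | const _ => 1
  | var _ => 1
  | add e f => e.cost + f.cost + 1
  | sub e f => e.cost + f.cost + 1

/-- Expressions with real values. The constants of a program are rational. -/
inductive RExpr where
  | const (c : ℚ)
  | var (x : ℕ)
  | read (a : ℕ) (i : IExpr)
  | add (e f : RExpr)
  | sub (e f : RExpr)
  | mul (e f : RExpr)
  | div (e f : RExpr)

/-- `read a i` is the entry with index `i` of array `a`. Division by zero returns zero. -/
noncomputable def RExpr.eval (σ : State) : RExpr → ℝ
  | const c => (c : ℝ)
  | var x => σ.real x
  | read a i => σ.arr a (i.eval σ)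
  | add e f => e.eval σ + f.eval σ
  | sub e f => e.eval σ - f.eval σ
  | mul e f => e.eval σ * f.eval σ
  | div e f => e.eval σ / f.eval σ

def RExpr.cost : RExpr → ℕ
  | const _ => 1
  | var _ => 1
  | read _ i => i.cost + 1
  | add e f => e.cost + f.cost + 1
  | sub e f => e.cost + f.cost + 1
  | mul e f => e.cost + f.cost + 1
  | div e f => e.cost + f.cost + 1

/-- Tests. -/
inductive Test where
  | intLt (e f : IExpr)
  | realLt (e f : RExpr)
  | not (b : Test)
  | and (b c : Test)

def Test.Holds (σ : State) : Test → Prop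
  | intLt e f => e.eval σ < f.eval σ
  | realLt e f => e.eval σ < f.eval σ
  | not b => ¬ b.Holds σ
  | and b c => b.Holds σ ∧ c.Holds σ

def Test.cost : Test → ℕ
  | intLt e f => e.cost + f.cost + 1
  | realLt e f => e.cost + f.cost + 1
  | not b => b.cost + 1
  | and b c => b.cost + c.cost + 1

/-- Programs. A program is a finite text that does not depend on the input. -/
inductive Prog where
  | skip
  | setInt (x : ℕ) (e : IExpr)
  | setReal (x : ℕ) (e : RExpr)
  | write (a : ℕ) (i : IExpr) (e : RExpr)
  | seq (p q : Prog)
  | branch (b : Test) (p q : Prog)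
  | loop (b : Test) (p : Prog)

def State.setInt (σ : State) (x : ℕ) (v : ℕ) : State :=
  { σ with int := Function.update σ.int x v }

noncomputable def State.setReal (σ : State) (x : ℕ) (v : ℝ) : State :=
  { σ with real := Function.update σ.real x v }

noncomputable def State.write (σ : State) (a i : ℕ) (v : ℝ) : State :=
  { σ with arr := Function.update σ.arr a (Function.update (σ.arr a) i v) }

/-- `Exec p σ t τ`: started in the state `σ`, the program `p` halts in the state `τ`
after exactly `t` time steps. -/
inductive Exec : Prog → State → ℕ → State → Prop where
  | skip (σ : State) : Exec Prog.skip σ 1 σ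
  | setInt (σ : State) (x : ℕ) (e : IExpr) :
      Exec (Prog.setInt x e) σ (e.cost + 1) (σ.setInt x (e.eval σ))
  | setReal (σ : State) (x : ℕ) (e : RExpr) :
      Exec (Prog.setReal x e) σ (e.cost + 1) (σ.setReal x (e.eval σ))
  | write (σ : State) (a : ℕ) (i : IExpr) (e : RExpr) :
      Exec (Prog.write a i e) σ (i.cost + e.cost + 1) (σ.write a (i.eval σ) (e.eval σ))
  | seq {p q : Prog} {σ τ υ : State} {t u : ℕ} :
      Exec p σ t τ → Exec q τ u υ → Exec (Prog.seq p q) σ (t + u) υ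
  | branchTrue {b : Test} {p q : Prog} {σ τ : State} {t : ℕ} :
      b.Holds σ → Exec p σ t τ → Exec (Prog.branch b p q) σ (b.cost + t) τ
  | branchFalse {b : Test} {p q : Prog} {σ τ : State} {t : ℕ} :
      ¬ b.Holds σ → Exec q σ t τ → Exec (Prog.branch b p q) σ (b.cost + t) τ
  | loopStop {b : Test} {p : Prog} {σ : State} :
      ¬ b.Holds σ → Exec (Prog.loop b p) σ b.cost σ
  | loopStep {b : Test} {p : Prog} {σ τ υ : State} {t u : ℕ} :
      b.Holds σ → Exec p σ t τ → Exec (Prog.loop b p) τ u υ →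
        Exec (Prog.loop b p) σ (b.cost + t + u) υ

/-- The state `σ` stores the list of points `L` in slot `q`: its length in the integer variable
`q`, the first coordinates in the array `2 * q`, the second ones in the array `2 * q + 1`. -/
def Stores (σ : State) (q : ℕ) (L : List (ℝ × ℝ)) : Prop :=
  σ.int q = L.length ∧
    ∀ i : Fin L.length,
      σ.arr (2 * q) i = (L.get i).1 ∧ σ.arr (2 * q + 1) i = (L.get i).2

end RealRAM

/-! ### Convex polygons -/

/-- Cross product of `b - a` and `c - a`; positive if and only if the triangle `a, b, c` is
nondegenerate and oriented counterclockwise. -/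
def planeOrient (a b c : ℝ × ℝ) : ℝ :=
  (b.1 - a.1) * (c.2 - a.2) - (b.2 - a.2) * (c.1 - a.1)

/-- `L` lists the vertices of the convex polygon (closed region) `S` in counterclockwise order,
each exactly once, starting anywhere. The condition on triples says that the listed points are in
strictly convex position and in counterclockwise order. Lists of length 0, 1 and 2 describe the
degenerate polygons: the empty set, a point and a segment. -/
def IsVertexList (L : List (ℝ × ℝ)) (S : Set (ℝ × ℝ)) : Prop :=
  L.Nodup ∧
  (∀ i j k : Fin L.length, i < j → j < k →
    0 < planeOrient (L.get i) (L.get j) (L.get k)) ∧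
  convexHull ℝ {p | p ∈ L} = S

/-! ### Trajectories and inscribed regular polygons -/

/-- A data point: position `(x, y)` at time `t`. -/
structure DataPoint where
  x : ℝ
  y : ℝ
  t : ℝ

/-- `P 0, ..., P n` is a trajectory: the times are strictly increasing. -/
def IsTrajectory (n : ℕ) (P : ℕ → DataPoint) : Prop :=
  ∀ i j : ℕ, i < j → j ≤ n → (P i).t < (P j).t

/-- The scaling factor from the plane of times `Q.t` to the plane of times `tc`, seen from `O`. -/
noncomputable def coneScale (O Q : DataPoint) (tc : ℝ) : ℝ :=
  (tc - O.t) / (Q.t - O.t)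

/-- The center, in the plane of time `tc`, of the projection circle of the cone with apex `O` over
the synchronous circle of `Q`. -/
noncomputable def coneCenter (O Q : DataPoint) (tc : ℝ) : ℝ × ℝ :=
  (O.x + coneScale O Q tc * (Q.x - O.x), O.y + coneScale O Q tc * (Q.y - O.y))

/-- The radius of that projection circle, if the synchronous circle has radius `ε`. -/
noncomputable def coneRadius (O Q : DataPoint) (ε tc : ℝ) : ℝ :=
  coneScale O Q tc * ε

/-- The vertex with label `j`, `1 ≤ j ≤ m`, of the regular `m`-gon inscribed in the circle with
center `c` and radius `r`; its polar coordinates around `c` are `(r, (j - 1) / m * 2π)`. -/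
noncomputable def regularVertex (m : ℕ) (c : ℝ × ℝ) (r : ℝ) (j : ℕ) : ℝ × ℝ :=
  (c.1 + r * Real.cos (((j : ℝ) - 1) / m * (2 * Real.pi)),
    c.2 + r * Real.sin (((j : ℝ) - 1) / m * (2 * Real.pi)))

/-- The regular `m`-gon (closed region) inscribed in the circle with center `c`, radius `r`. -/
noncomputable def regularPolygon (m : ℕ) (c : ℝ × ℝ) (r : ℝ) : Set (ℝ × ℝ) :=
  convexHull ℝ (regularVertex m c r '' Set.Icc 1 m)

/-- The polygon `R_{s+i}`: the regular `m`-gon inscribed in the projection circle, in the plane of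
time `tc`, of the cone with apex `P s` over the synchronous circle of `P (s + i)`. -/
noncomputable def inscribedPolygon (m : ℕ) (P : ℕ → DataPoint) (s : ℕ) (ε tc : ℝ) (i : ℕ) :
    Set (ℝ × ℝ) :=
  regularPolygon m (coneCenter (P s) (P (s + i)) tc) (coneRadius (P s) (P (s + i)) ε tc)

/-- The polygon `R*_l`: the common intersection of `R_{s+1}, ..., R_{s+l}`. -/
noncomputable def inscribedIntersection (m : ℕ) (P : ℕ → DataPoint) (s : ℕ) (ε tc : ℝ) (l : ℕ) :
    Set (ℝ × ℝ) :=
  ⋂ i ∈ Set.Icc 1 l, inscribedPolygon m P s ε tc i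

/-! ### Orientation of triples and cyclic vertex access -/

/-! The size bound rests on one geometric fact: all the polygons R_{s+i} are homothetic with
positive ratio, so their edges have the same inner normals. Hence R*_l is cut out by half-planes
with at most m normal directions, however large l is. Two extreme points with the same set of active
directions coincide (`length_le_of_extremePoints`), so R*_l has at most 2^m vertices
(`inscribedIntersection_length_le`). This is coarser than the optimal bound m, but any bound
independent of l suffices.

The intersection itself is found by clipping. A convex polygon with at least three vertices is the
intersection of its edge half-planes (`IsVertexList.eq_edgeHalfPlanes`), so it is enough to clip the
list of R*_l by the edges of the other polygon, one after another. One clip turns a vertex list into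
a vertex list (`IsVertexList.clip`): strict convexity survives because the orientation is affine in
each of its points (`clip_orient_pos`), and the region is the right one by `clip_hull`. A clip costs
time linear in the length of the list and at most doubles that length. The second polygon has
between 3 and m vertices, so all lengths stay below 2^m * 2^m and the total time depends on m alone.

For the machine, `Runs` is a total-correctness statement with a time bound. `runs_clipProg` and
`runs_intersectProg` identify the output of the loops with the lists `clip` and `clipEdges`. -/

theorem planeOrient_rotate (a b c : ℝ × ℝ) : planeOrient a b c = planeOrient b c a := by
  unfold planeOrient; ring

theorem planeOrient_combo (a b x y : ℝ × ℝ) {s t : ℝ} (h : s + t = 1) :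
    planeOrient a b (s • x + t • y) = s * planeOrient a b x + t * planeOrient a b y := by
  obtain rfl : s = 1 - t := by linarith
  simp only [planeOrient, Prod.fst_add, Prod.snd_add, Prod.smul_fst, Prod.smul_snd, smul_eq_mul]
  ring

theorem convex_halfPlane (a b : ℝ × ℝ) : Convex ℝ {x | 0 ≤ planeOrient a b x} := by
  intro x hx y hy s t hs ht hst
  simp only [Set.mem_ofPred_eq] at *
  rw [planeOrient_combo a b x y hst]
  positivity

theorem Convex.smul_add_smul_add_smul_mem {S : Set (ℝ × ℝ)} (hS : Convex ℝ S) {u v w : ℝ}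
    (hu : 0 ≤ u) (hv : 0 ≤ v) (hw : 0 ≤ w) (h : u + v + w = 1) {x y z : ℝ × ℝ} (hx : x ∈ S)
    (hy : y ∈ S) (hz : z ∈ S) : u • x + v • y + w • z ∈ S := by
  have := hS.sum_mem (t := Finset.univ) (w := ![u, v, w]) (z := ![x, y, z])
    (by intro i _; fin_cases i <;> simpa) (by simpa [Fin.sum_univ_three] using h)
    (by intro i _; fin_cases i <;> simpa)
  simpa [Fin.sum_univ_three] using this

/-- The entry of `L` with index `i`, where indices are read cyclically. -/
def vtx (L : List (ℝ × ℝ)) (i : ℕ) : ℝ × ℝ := L.getD (i % L.length) 0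

/-- Increasing triples of entries are oriented counterclockwise. -/
def StrictlyConvex (L : List (ℝ × ℝ)) : Prop :=
  ∀ i j k : Fin L.length, i < j → j < k → 0 < planeOrient (L.get i) (L.get j) (L.get k)

section vtx

variable {L : List (ℝ × ℝ)}

theorem vtx_eq_get (i : Fin L.length) : vtx L i = L.get i := by
  simp [vtx, Nat.mod_eq_of_lt i.2]

theorem vtx_eq_getElem {i : ℕ} (h : i < L.length) : vtx L i = L[i] := by
  simp [vtx, Nat.mod_eq_of_lt h, h]

theorem vtx_length : vtx L L.length = vtx L 0 := by
  simp [vtx]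

theorem vtx_mem (h : 0 < L.length) (i : ℕ) : vtx L i ∈ L := by
  have := Nat.mod_lt i h
  simp [vtx, this]

theorem exists_vtx_eq {p : ℝ × ℝ} (h : p ∈ L) : ∃ i < L.length, vtx L i = p := by
  obtain ⟨i, hi, rfl⟩ := List.mem_iff_getElem.1 h
  exact ⟨i, hi, vtx_eq_getElem hi⟩

theorem vtx_injOn (h : L.Nodup) {i j : ℕ} (hi : i < L.length) (hj : j < L.length)
    (hij : vtx L i = vtx L j) : i = j := by
  rw [vtx_eq_getElem hi, vtx_eq_getElem hj] at hij
  exact (h.getElem_inj_iff).1 hij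

theorem vtx_succ_ne (h : L.Nodup) (h2 : 2 ≤ L.length) {i : ℕ} (hi : i < L.length) :
    vtx L i ≠ vtx L (i + 1) := by
  intro e
  rcases Nat.lt_or_ge (i + 1) L.length with h1 | h1
  · have := vtx_injOn h hi h1 e
    omega
  · have : i + 1 = L.length := by omega
    rw [this, vtx_length] at e
    have := vtx_injOn h hi (by omega) e
    omega

/-- The index `L.length` is allowed and stands for vertex 0, so that the closing edge needs no
separate treatment. The last hypothesis excludes only `i = 0`, `k = L.length`, where two of the
points coincide. -/
theorem StrictlyConvex.pos (h : StrictlyConvex L) {i j k : ℕ} (hij : i < j) (hjk : j < k)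
    (hk : k ≤ L.length) (hki : k < i + L.length) :
    0 < planeOrient (vtx L i) (vtx L j) (vtx L k) := by
  rcases Nat.lt_or_ge k L.length with h1 | h1
  · simpa only [vtx_eq_get] using (vtx_eq_get (⟨i, by omega⟩ : Fin L.length)) ▸
      (vtx_eq_get (⟨j, by omega⟩ : Fin L.length)) ▸ (vtx_eq_get (⟨k, h1⟩ : Fin L.length)) ▸
      h ⟨i, by omega⟩ ⟨j, by omega⟩ ⟨k, h1⟩ hij hjk
  · obtain rfl : k = L.length := by omega
    rw [vtx_length, ← planeOrient_rotate]
    have := h ⟨0, by omega⟩ ⟨i, by omega⟩ ⟨j, by omega⟩ (Fin.mk_lt_mk.2 (by omega)) hij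
    rw [← vtx_eq_get, ← vtx_eq_get, ← vtx_eq_get] at this
    exact this

theorem StrictlyConvex.nonneg (h : StrictlyConvex L) {i j k : ℕ} (hij : i ≤ j) (hjk : j ≤ k)
    (hk : k ≤ L.length) : 0 ≤ planeOrient (vtx L i) (vtx L j) (vtx L k) := by
  rcases hij.eq_or_lt with rfl | hij
  · simp [planeOrient]
  rcases hjk.eq_or_lt with rfl | hjk
  · apply le_of_eq; unfold planeOrient; ring
  rcases Nat.lt_or_ge k (i + L.length) with h1 | h1
  · exact (h.pos hij hjk hk h1).le
  · obtain ⟨rfl, rfl⟩ : i = 0 ∧ k = L.length := by omega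
    rw [vtx_length]
    simp [planeOrient]

theorem StrictlyConvex.edge_nonneg (h : StrictlyConvex L) {j k : ℕ} (hj : j < L.length)
    (hk : k < L.length) : 0 ≤ planeOrient (vtx L j) (vtx L (j + 1)) (vtx L k) := by
  rcases Nat.lt_or_ge j k with h1 | h1
  · exact h.nonneg (by omega) (by omega) hk.le
  · rw [← planeOrient_rotate]
    exact h.nonneg h1 (by omega) (by omega)

theorem StrictlyConvex.edge_pos (h : StrictlyConvex L) {j k : ℕ} (hj : j < L.length)
    (hk : k < L.length) (hne : k ≠ j) (hne' : k ≠ (j + 1) % L.length) :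
    0 < planeOrient (vtx L j) (vtx L (j + 1)) (vtx L k) := by
  have h3 : j + 1 < L.length ∨ j + 1 = L.length := by omega
  have hne2 : (j + 1 < L.length ∧ k ≠ j + 1) ∨ (j + 1 = L.length ∧ k ≠ 0) := by
    rcases h3 with h3 | h3
    · rw [Nat.mod_eq_of_lt h3] at hne'; exact Or.inl ⟨h3, hne'⟩
    · rw [h3, Nat.mod_self] at hne'; exact Or.inr ⟨h3, hne'⟩
  rcases Nat.lt_or_ge j k with h1 | h1
  · exact h.pos (by omega) (by omega) hk.le (by omega)
  · rw [← planeOrient_rotate]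
    exact h.pos (by omega) (by omega) (by omega) (by omega)

theorem StrictlyConvex.hull_edge_nonneg (h : StrictlyConvex L) {j : ℕ} (hj : j < L.length)
    {x : ℝ × ℝ} (hx : x ∈ convexHull ℝ {p | p ∈ L}) :
    0 ≤ planeOrient (vtx L j) (vtx L (j + 1)) x := by
  refine convexHull_min (fun p hp => ?_) (convex_halfPlane _ _) hx
  obtain ⟨k, hk, rfl⟩ := exists_vtx_eq hp
  exact h.edge_nonneg hj hk

/-- A point on the inner side of all edge lines lies in the polygon. -/
theorem StrictlyConvex.mem_hull (h : StrictlyConvex L) (h3 : 3 ≤ L.length) {x : ℝ × ℝ}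
    (hx : ∀ j < L.length, 0 ≤ planeOrient (vtx L j) (vtx L (j + 1)) x) :
    x ∈ convexHull ℝ {p | p ∈ L} := by
  have hlast : planeOrient (vtx L 0) (vtx L (L.length - 2 + 1)) x ≤ 0 := by
    have h1 := hx (L.length - 2 + 1) (by omega)
    rw [show L.length - 2 + 1 + 1 = L.length by omega, vtx_length] at h1
    unfold planeOrient at h1 ⊢
    linarith
  -- Fan triangulation from vertex 0: the first diagonal that does not leave `x` strictly on its
  -- left singles out the triangle with vertices 0, `i`, `i + 1` containing `x`.
  have hex : ∃ i, 1 ≤ i ∧ planeOrient (vtx L 0) (vtx L (i + 1)) x ≤ 0 :=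
    ⟨_, by omega, hlast⟩
  classical
  let i := Nat.find hex
  obtain ⟨hi1, hi2⟩ : 1 ≤ i ∧ planeOrient (vtx L 0) (vtx L (i + 1)) x ≤ 0 := Nat.find_spec hex
  have hin : i ≤ L.length - 2 := Nat.find_min' hex ⟨by omega, hlast⟩
  have hi3 : 0 ≤ planeOrient (vtx L 0) (vtx L i) x := by
    rcases hi1.eq_or_lt with h1 | h1
    · rw [← h1]; exact hx 0 (by omega)
    · have := Nat.find_min hex (m := i - 1) (by omega)
      rw [show i - 1 + 1 = i by omega] at this
      by_contra hc
      exact this ⟨by omega, by linarith⟩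
  have hi4 := hx i (by omega)
  have hT := h.pos (i := 0) (j := i) (k := i + 1) (by omega) (by omega) (by omega) (by omega)
  have hm : ∀ i, vtx L i ∈ convexHull ℝ {p | p ∈ L} := fun i =>
    subset_convexHull ℝ _ (vtx_mem (by omega) i)
  generalize i = i at *
  -- Barycentric coordinates in that triangle are quotients of orientations.
  have e : x = (planeOrient (vtx L i) (vtx L (i + 1)) x /
        planeOrient (vtx L 0) (vtx L i) (vtx L (i + 1))) • vtx L 0 +
      (-planeOrient (vtx L 0) (vtx L (i + 1)) x /
        planeOrient (vtx L 0) (vtx L i) (vtx L (i + 1))) • vtx L i +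
      (planeOrient (vtx L 0) (vtx L i) x /
        planeOrient (vtx L 0) (vtx L i) (vtx L (i + 1))) • vtx L (i + 1) := by
    ext
    · simp only [Prod.fst_add, Prod.smul_fst, smul_eq_mul]
      field_simp
      unfold planeOrient; ring
    · simp only [Prod.snd_add, Prod.smul_snd, smul_eq_mul]
      field_simp
      unfold planeOrient; ring
  rw [e]
  refine (convex_convexHull ℝ {p | p ∈ L}).smul_add_smul_add_smul_mem ?_ ?_ ?_ ?_
    (hm _) (hm _) (hm _)
  · exact div_nonneg hi4 hT.le
  · exact div_nonneg (by linarith) hT.le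
  · exact div_nonneg hi3 hT.le
  · field_simp
    unfold planeOrient; ring

end vtx

/-! ### Vertices are extreme points -/

/-- The set consisting of `p` and the open half-plane `g p < g x` is convex, so it contains the
hull. A proper convex combination with value `g p` can therefore only use `p` itself. -/
theorem mem_extremePoints_of_unique_min {T : Set (ℝ × ℝ)} {p : ℝ × ℝ} (hp : p ∈ T)
    (g : ℝ × ℝ →ₗ[ℝ] ℝ) (hg : ∀ q ∈ T, q ≠ p → g p < g q) :
    p ∈ (convexHull ℝ T).extremePoints ℝ := by
  have hsub : ∀ x ∈ convexHull ℝ T, x = p ∨ g p < g x := by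
    have hc : Convex ℝ {x | x = p ∨ g p < g x} := by
      intro x hx y hy s t hs ht hst
      have hle : ∀ z, (z = p ∨ g p < g z) → g p ≤ g z := by
        rintro z (rfl | h)
        exacts [le_rfl, h.le]
      have hx' := hle x hx
      have hy' := hle y hy
      rcases hs.eq_or_lt with rfl | hs
      · obtain rfl : t = 1 := by linarith
        simpa using hy
      rcases ht.eq_or_lt with rfl | ht
      · obtain rfl : s = 1 := by linarith
        simpa using hx
      by_cases h : x = p ∧ y = p
      · left
        rw [h.1, h.2, ← add_smul, hst, one_smul]
      · right
        have e : g p = s * g p + t * g p := by rw [← add_mul, hst, one_mul]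
        rw [map_add, map_smul, map_smul, smul_eq_mul, smul_eq_mul, e]
        rcases hx with rfl | hx
        · rcases hy with rfl | hy
          · simp at h
          · nlinarith
        · nlinarith
    exact fun x hx => convexHull_min (fun q hq => by
      by_cases h : q = p
      exacts [Or.inl h, Or.inr (hg q hq h)]) hc hx
  have key : ∀ x ∈ convexHull ℝ T, ∀ y ∈ convexHull ℝ T, p ∈ openSegment ℝ x y → x = p := by
    rintro x hx y hy ⟨s, t, hs, ht, hst, e⟩
    rcases hsub x hx with h | h
    · exact h
    · have hy' : g p ≤ g y := by
        rcases hsub y hy with h | h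
        exacts [h ▸ le_rfl, h.le]
      have := congrArg g e
      rw [map_add, map_smul, map_smul, smul_eq_mul, smul_eq_mul] at this
      have e2 : g p = s * g p + t * g p := by rw [← add_mul, hst, one_mul]
      nlinarith
  rw [mem_extremePoints]
  refine ⟨subset_convexHull ℝ T hp, fun x hx y hy h => ⟨key x hx y hy h, key y hy x hx ?_⟩⟩
  rwa [openSegment_symm]

/-- The linear part of `planeOrient a b`. -/
noncomputable def edgeForm (a b : ℝ × ℝ) : ℝ × ℝ →ₗ[ℝ] ℝ :=
  (b.1 - a.1) • LinearMap.snd ℝ ℝ ℝ - (b.2 - a.2) • LinearMap.fst ℝ ℝ ℝ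

theorem planeOrient_eq_edgeForm (a b x : ℝ × ℝ) :
    planeOrient a b x = edgeForm a b x - edgeForm a b a := by
  simp [planeOrient, edgeForm]; ring

/-- With at least three vertices, the sum of the linear forms of the two edges at a vertex is
minimal at that vertex only. With fewer, the form in the direction of the other vertex, if there is
one, does the job. -/
theorem IsVertexList.mem_extremePoints {L : List (ℝ × ℝ)} {S : Set (ℝ × ℝ)}
    (h : IsVertexList L S) {p : ℝ × ℝ} (hp : p ∈ L) : p ∈ S.extremePoints ℝ := by
  obtain ⟨hnd, hc, rfl⟩ := h
  have hc : StrictlyConvex L := hc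
  obtain ⟨i, hi, rfl⟩ := exists_vtx_eq hp
  rcases Nat.lt_or_ge L.length 3 with h3 | h3
  · apply mem_extremePoints_of_unique_min hp
      ((vtx L (i + 1) - vtx L i).1 • LinearMap.fst ℝ ℝ ℝ +
        (vtx L (i + 1) - vtx L i).2 • LinearMap.snd ℝ ℝ ℝ)
    intro q hq hne
    obtain ⟨k, hk, rfl⟩ := exists_vtx_eq hq
    have hki : k ≠ i := fun e => hne (by rw [e])
    have : vtx L k = vtx L (i + 1) := by
      unfold vtx
      congr 1
      have h2 : L.length = 2 := by omega
      rw [h2]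
      omega
    rw [this] at hne ⊢
    have h0 : 0 < ((vtx L (i + 1)).1 - (vtx L i).1) ^ 2 + ((vtx L (i + 1)).2 - (vtx L i).2) ^ 2 := by
      by_contra hcon
      apply hne
      have e1 : ((vtx L (i + 1)).1 - (vtx L i).1) = 0 := by
        nlinarith [sq_nonneg ((vtx L (i + 1)).1 - (vtx L i).1),
          sq_nonneg ((vtx L (i + 1)).2 - (vtx L i).2)]
      have e2 : ((vtx L (i + 1)).2 - (vtx L i).2) = 0 := by
        nlinarith [sq_nonneg ((vtx L (i + 1)).1 - (vtx L i).1),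
          sq_nonneg ((vtx L (i + 1)).2 - (vtx L i).2)]
      exact Prod.ext (by linarith) (by linarith)
    simp
    nlinarith
  · obtain ⟨j, hj, hji⟩ : ∃ j < L.length, (j + 1) % L.length = i := by
      rcases Nat.eq_zero_or_pos i with rfl | h0
      · exact ⟨L.length - 1, by omega, by rw [show L.length - 1 + 1 = L.length by omega]; simp⟩
      · exact ⟨i - 1, by omega, by rw [show i - 1 + 1 = i by omega, Nat.mod_eq_of_lt hi]⟩
    have hji' : vtx L (j + 1) = vtx L i := by
      rw [← hji]; simp [vtx]
    apply mem_extremePoints_of_unique_min hp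
      (edgeForm (vtx L i) (vtx L (i + 1)) + edgeForm (vtx L j) (vtx L i))
    intro q hq hne
    obtain ⟨k, hk, rfl⟩ := exists_vtx_eq hq
    have hki : k ≠ i := fun e => hne (by rw [e])
    have h1 := hc.edge_nonneg hi hk
    have h2 := hc.edge_nonneg hj hk
    -- Another vertex can lie on the line of only one of the two adjacent edges, because the two
    -- neighbours of `i` are different.
    have h12 : 0 < planeOrient (vtx L i) (vtx L (i + 1)) (vtx L k) ∨
        0 < planeOrient (vtx L j) (vtx L (j + 1)) (vtx L k) := by
      by_cases hkj : k = j
      · left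
        apply hc.edge_pos hi hk hki
        rcases Nat.lt_or_ge (j + 1) L.length with h | h <;>
        rcases Nat.lt_or_ge (i + 1) L.length with h' | h'
        · rw [Nat.mod_eq_of_lt h'] ; rw [Nat.mod_eq_of_lt h] at hji; omega
        · rw [show i + 1 = L.length by omega, Nat.mod_self]
          rw [Nat.mod_eq_of_lt h] at hji; omega
        · rw [Nat.mod_eq_of_lt h']
          rw [show j + 1 = L.length by omega, Nat.mod_self] at hji; omega
        · rw [show j + 1 = L.length by omega, Nat.mod_self] at hji; omega
      · right
        exact hc.edge_pos hj hk hkj (by omega)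
    rw [hji'] at h2 h12
    have e3 : planeOrient (vtx L j) (vtx L i) (vtx L i) = 0 := by unfold planeOrient; ring
    rw [planeOrient_eq_edgeForm] at h1 h2 h12 e3
    rw [planeOrient_eq_edgeForm] at h12
    simp only [LinearMap.add_apply]
    rcases h12 with h | h <;> linarith

/-! ### Clipping a convex polygon by a half-plane -/

/-- The point where the line `a b` crosses the segment from `p` to `q`. -/
noncomputable def crossPoint (a b p q : ℝ × ℝ) : ℝ × ℝ :=
  (p.1 + planeOrient a b p / (planeOrient a b p - planeOrient a b q) * (q.1 - p.1),
    p.2 + planeOrient a b p / (planeOrient a b p - planeOrient a b q) * (q.2 - p.2))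

/-- Boundary positions of the clipped polygon: `2 * i` stands for the vertex `i`,
`2 * i + 1` for the crossing of the edge from vertex `i` to its successor. -/
noncomputable def clipPoint (a b : ℝ × ℝ) (L : List (ℝ × ℝ)) (k : ℕ) : ℝ × ℝ :=
  if k % 2 = 0 then vtx L (k / 2) else crossPoint a b (vtx L (k / 2)) (vtx L (k / 2 + 1))

/-- The boundary positions that survive the clipping. The return edge of a segment is ignored. -/
def ClipKeep (a b : ℝ × ℝ) (L : List (ℝ × ℝ)) (k : ℕ) : Prop :=
  if k % 2 = 0 then 0 ≤ planeOrient a b (vtx L (k / 2))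
  else planeOrient a b (vtx L (k / 2)) * planeOrient a b (vtx L (k / 2 + 1)) < 0 ∧
    (k / 2 + 1 < L.length ∨ 2 < L.length)

open Classical in
/-- The surviving points among the first `k` boundary positions. -/
noncomputable def clipPrefix (a b : ℝ × ℝ) (L : List (ℝ × ℝ)) (k : ℕ) : List (ℝ × ℝ) :=
  ((List.range k).filter fun i => ClipKeep a b L i).map (clipPoint a b L)

/-- The polygon `L` clipped by the half-plane on the left of the line `a b`. -/
noncomputable def clip (a b : ℝ × ℝ) (L : List (ℝ × ℝ)) : List (ℝ × ℝ) :=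
  clipPrefix a b L (2 * L.length)

section clip

variable {a b : ℝ × ℝ} {L : List (ℝ × ℝ)}

@[simp] theorem clipPoint_even (i : ℕ) : clipPoint a b L (2 * i) = vtx L i := by
  simp [clipPoint]

@[simp] theorem clipPoint_odd (i : ℕ) :
    clipPoint a b L (2 * i + 1) = crossPoint a b (vtx L i) (vtx L (i + 1)) := by
  have h1 : (2 * i + 1) % 2 = 1 := by omega
  have h2 : (2 * i + 1) / 2 = i := by omega
  simp [clipPoint, h1, h2]

@[simp] theorem clipKeep_even (i : ℕ) :
    ClipKeep a b L (2 * i) ↔ 0 ≤ planeOrient a b (vtx L i) := by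
  simp [ClipKeep]

@[simp] theorem clipKeep_odd (i : ℕ) :
    ClipKeep a b L (2 * i + 1) ↔
      planeOrient a b (vtx L i) * planeOrient a b (vtx L (i + 1)) < 0 ∧
        (i + 1 < L.length ∨ 2 < L.length) := by
  have h1 : (2 * i + 1) % 2 = 1 := by omega
  have h2 : (2 * i + 1) / 2 = i := by omega
  simp [ClipKeep, h1, h2]

theorem clipPrefix_length_le (k : ℕ) : (clipPrefix a b L k).length ≤ k := by
  unfold clipPrefix
  rw [List.length_map]
  exact (List.length_filter_le _ _).trans (by simp)

theorem clip_length_le : (clip a b L).length ≤ 2 * L.length := clipPrefix_length_le _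

@[simp] theorem clipPrefix_zero : clipPrefix a b L 0 = [] := by simp [clipPrefix]

-- An edge contributes two positions, its starting vertex and its crossing. This is the recursion
-- that one pass of the clipping loop carries out.
open Classical in
theorem clipPrefix_succ (i : ℕ) :
    clipPrefix a b L (2 * (i + 1)) = clipPrefix a b L (2 * i) ++
      (if 0 ≤ planeOrient a b (vtx L i) then [vtx L i] else []) ++
      (if planeOrient a b (vtx L i) * planeOrient a b (vtx L (i + 1)) < 0 ∧
        (i + 1 < L.length ∨ 2 < L.length)
        then [crossPoint a b (vtx L i) (vtx L (i + 1))] else []) := by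
  unfold clipPrefix
  rw [show 2 * (i + 1) = 2 * i + 1 + 1 by ring, List.range_succ, List.range_succ]
  simp only [List.filter_append, List.map_append, List.filter_cons, List.filter_nil,
    decide_eq_true_eq, clipKeep_even, clipKeep_odd]
  congr 1
  · congr 1
    split_ifs <;> simp
  · split_ifs <;> simp

theorem mem_clip {p : ℝ × ℝ} :
    p ∈ clip a b L ↔ ∃ k < 2 * L.length, ClipKeep a b L k ∧ clipPoint a b L k = p := by
  simp [clip, clipPrefix, and_assoc]

theorem crossPoint_eq {p q : ℝ × ℝ} (h : planeOrient a b p * planeOrient a b q < 0) :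
    ∃ s : ℝ, 0 < s ∧ s < 1 ∧ crossPoint a b p q = (1 - s) • p + s • q := by
  refine ⟨planeOrient a b p / (planeOrient a b p - planeOrient a b q), ?_, ?_, ?_⟩
  · rcases mul_neg_iff.1 h with ⟨h1, h2⟩ | ⟨h1, h2⟩
    · exact div_pos h1 (by linarith)
    · exact div_pos_of_neg_of_neg h1 (by linarith)
  · rcases mul_neg_iff.1 h with ⟨h1, h2⟩ | ⟨h1, h2⟩
    · rw [div_lt_one (by linarith)]; linarith
    · rw [div_lt_one_of_neg (by linarith)]; linarith
  · ext <;> simp [crossPoint] <;> ring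

theorem planeOrient_crossPoint {p q : ℝ × ℝ} (h : planeOrient a b p ≠ planeOrient a b q) :
    planeOrient a b (crossPoint a b p q) = 0 := by
  have hne := sub_ne_zero.2 h
  have e : planeOrient a b (crossPoint a b p q) = planeOrient a b p +
      planeOrient a b p / (planeOrient a b p - planeOrient a b q) *
        (planeOrient a b q - planeOrient a b p) := by
    simp only [crossPoint]
    generalize planeOrient a b p / (planeOrient a b p - planeOrient a b q) = s
    unfold planeOrient
    ring
  rw [e]
  field_simp
  ring

/-- A boundary position is a point of the half-open edge from a vertex to its successor. -/
theorem clipPoint_eq {k : ℕ} (hk : ClipKeep a b L k) :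
    ∃ s : ℝ, 0 ≤ s ∧ s < 1 ∧ (k % 2 = 0 → s = 0) ∧ (k % 2 = 1 → 0 < s) ∧
      clipPoint a b L k = (1 - s) • vtx L (k / 2) + s • vtx L (k / 2 + 1) := by
  rcases Nat.even_or_odd' k with ⟨i, rfl | rfl⟩
  · exact ⟨0, le_rfl, one_pos, fun _ => rfl, fun h => by omega, by simp⟩
  · rw [clipKeep_odd] at hk
    obtain ⟨s, h0, h1, e⟩ := crossPoint_eq hk.1
    refine ⟨s, h0.le, h1, fun h => by omega, fun _ => h0, ?_⟩
    rw [clipPoint_odd, e, show (2 * i + 1) / 2 = i by omega]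

/-- The two end points of a crossed edge do not both survive. -/
theorem not_keep_ends {k i : ℕ} (hk : ClipKeep a b L k) (h1 : k % 2 = 1) (hi : k / 2 = i)
    (h2 : 0 ≤ planeOrient a b (vtx L i)) (h3 : 0 ≤ planeOrient a b (vtx L (i + 1))) : False := by
  obtain rfl : k = 2 * i + 1 := by omega
  rw [clipKeep_odd] at hk
  exact absurd hk.1 (not_lt.2 (mul_nonneg h2 h3))

theorem planeOrient_combo₃ (p q x y : ℝ × ℝ) (s : ℝ) :
    planeOrient p q ((1 - s) • x + s • y) =
      (1 - s) * planeOrient p q x + s * planeOrient p q y :=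
  planeOrient_combo p q x y (by ring)

theorem planeOrient_combo₁ (p q x y : ℝ × ℝ) (s : ℝ) :
    planeOrient ((1 - s) • x + s • y) p q =
      (1 - s) * planeOrient x p q + s * planeOrient y p q := by
  rw [planeOrient_rotate, planeOrient_combo₃, planeOrient_rotate x, planeOrient_rotate y]

theorem planeOrient_combo₂ (p q x y : ℝ × ℝ) (s : ℝ) :
    planeOrient p ((1 - s) • x + s • y) q =
      (1 - s) * planeOrient p x q + s * planeOrient p y q := by
  rw [← planeOrient_rotate, planeOrient_combo₃, ← planeOrient_rotate q p x,
    ← planeOrient_rotate q p y]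

theorem planeOrient_self₁₂ (p q : ℝ × ℝ) : planeOrient p p q = 0 := by unfold planeOrient; ring
theorem planeOrient_self₂₃ (p q : ℝ × ℝ) : planeOrient p q q = 0 := by unfold planeOrient; ring
theorem planeOrient_self₁₃ (p q : ℝ × ℝ) : planeOrient p q p = 0 := by unfold planeOrient; ring

theorem keep_even {k : ℕ} (hk : ClipKeep a b L k) (h : k % 2 = 0) :
    0 ≤ planeOrient a b (vtx L (k / 2)) := by
  simpa [ClipKeep, h] using hk

/-- Each surviving point is a convex combination of two consecutive vertices. Expanding in all three
arguments gives a nonnegative combination of orientations of vertices, and only some positive term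
has to be found. If the three edges are distinct, the leading term is positive; if two positions
share an edge, they are its starting vertex and its crossing. -/
theorem clip_orient_pos (h : StrictlyConvex L) (h3 : 3 ≤ L.length) {i j k : ℕ}
    (hij : i < j) (hjk : j < k) (hk : k < 2 * L.length) (Ki : ClipKeep a b L i)
    (Kj : ClipKeep a b L j) (Kk : ClipKeep a b L k) :
    0 < planeOrient (clipPoint a b L i) (clipPoint a b L j) (clipPoint a b L k) := by
  obtain ⟨s, hs0, hs1, hse, hso, es⟩ := clipPoint_eq Ki
  obtain ⟨t, ht0, ht1, hte, hto, et⟩ := clipPoint_eq Kj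
  obtain ⟨u, hu0, hu1, hue, huo, eu⟩ := clipPoint_eq Kk
  have hs1' : 0 < 1 - s := by linarith
  have ht1' : 0 < 1 - t := by linarith
  have hu1' : 0 < 1 - u := by linarith
  rw [es, et, eu]
  have keepi : i % 2 = 0 → 0 ≤ planeOrient a b (vtx L (i / 2)) := keep_even Ki
  have keepj : j % 2 = 0 → 0 ≤ planeOrient a b (vtx L (j / 2)) := keep_even Kj
  have keepk : k % 2 = 0 → 0 ≤ planeOrient a b (vtx L (k / 2)) := keep_even Kk
  rcases Nat.lt_or_ge (i / 2) (j / 2) with c1 | c1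
  · rcases Nat.lt_or_ge (j / 2) (k / 2) with c2 | c2
    · generalize i / 2 = i' at *
      generalize j / 2 = j' at *
      have hk' : k / 2 + 1 ≤ L.length := by omega
      generalize k / 2 = k' at *
      simp only [planeOrient_combo₁, planeOrient_combo₂, planeOrient_combo₃]
      have q0 := h.pos c1 c2 (by omega) (by omega)
      have q1 := h.nonneg (i := i') (j := j') (k := k' + 1) (by omega) (by omega) (by omega)
      have q2 := h.nonneg (i := i') (j := j' + 1) (k := k') (by omega) (by omega) (by omega)
      have q3 := h.nonneg (i := i') (j := j' + 1) (k := k' + 1) (by omega) (by omega) (by omega)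
      have q4 := h.nonneg (i := i' + 1) (j := j') (k := k') (by omega) (by omega) (by omega)
      have q5 := h.nonneg (i := i' + 1) (j := j') (k := k' + 1) (by omega) (by omega) (by omega)
      have q6 := h.nonneg (i := i' + 1) (j := j' + 1) (k := k') (by omega) (by omega) (by omega)
      have q7 := h.nonneg (i := i' + 1) (j := j' + 1) (k := k' + 1) (by omega) (by omega)
        (by omega)
      positivity
    · have c3 : j / 2 = k / 2 := by omega
      have hu := huo (by omega)
      obtain rfl := hte (by omega)
      have hj0 := keepj (by omega)
      have hkn : ¬ 0 ≤ planeOrient a b (vtx L (j / 2 + 1)) :=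
        fun hc => not_keep_ends Kk (by omega) c3.symm hj0 hc
      rw [← c3] at *
      have hj' : j / 2 + 1 ≤ L.length := by omega
      generalize j / 2 = j' at *
      simp only [sub_zero, one_smul, zero_smul, add_zero, planeOrient_combo₁,
        planeOrient_combo₃, planeOrient_self₂₃, mul_zero, zero_add]
      have q1 := h.nonneg (i := i / 2 + 1) (j := j') (k := j' + 1) (by omega) (by omega)
        (by omega)
      -- Here the leading term vanishes because `j' + 1` wraps around to vertex 0. That vertex was
      -- cut off, so position `i` must be a crossing, and its weight on vertex 1 is positive.
      by_cases c4 : i / 2 = 0 ∧ j' + 1 = L.length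
      · rw [c4.2, vtx_length, ← c4.1] at hkn
        have hi1 : i % 2 = 1 := by
          by_contra hc
          exact hkn (keepi (by omega))
        have hs := hso hi1
        have q2 := h.pos (i := 0 + 1) (j := j') (k := j' + 1) (by omega) (by omega) (by omega)
          (by omega)
        rw [c4.1]
        have q3 := h.nonneg (i := 0) (j := j') (k := j' + 1) (by omega) (by omega) (by omega)
        positivity
      · have q2 := h.pos (i := i / 2) (j := j') (k := j' + 1) (by omega) (by omega) (by omega)
          (by omega)
        positivity
  · have c3 : i / 2 = j / 2 := by omega
    have ht := hto (by omega)
    obtain rfl := hse (by omega)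
    have hi0 := keepi (by omega)
    have hin : ¬ 0 ≤ planeOrient a b (vtx L (i / 2 + 1)) :=
      fun hc => not_keep_ends Kj (by omega) c3.symm hi0 hc
    rw [← c3] at *
    have hik : i / 2 < k / 2 := by omega
    have hk' : k / 2 + 1 ≤ L.length := by omega
    generalize i / 2 = i' at *
    simp only [sub_zero, one_smul, zero_smul, add_zero, planeOrient_combo₂,
      planeOrient_combo₃, planeOrient_self₁₂, mul_zero, zero_add]
    have q1 := h.nonneg (i := i') (j := i' + 1) (k := k / 2) (by omega) (by omega) (by omega)
    have q2 := h.nonneg (i := i') (j := i' + 1) (k := k / 2 + 1) (by omega) (by omega) (by omega)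
    -- If the third point starts at the end of the shared edge, that end was cut off. So the third
    -- point is a crossing, with positive weight on the following vertex.
    by_cases c4 : k / 2 = i' + 1
    · have hk1 : k % 2 = 1 := by
        by_contra hc
        rw [← c4] at hin
        exact hin (keepk (by omega))
      have hu := huo hk1
      have q3 := h.pos (i := i') (j := i' + 1) (k := k / 2 + 1) (by omega) (by omega) (by omega)
        (by omega)
      positivity
    · have q3 := h.pos (i := i') (j := i' + 1) (k := k / 2) (by omega) (by omega) (by omega)
        (by omega)
      positivity

theorem combo_ne {p q : ℝ × ℝ} {s : ℝ} (h : p ≠ q) (hs : s ≠ 0) : (1 - s) • p + s • q ≠ p := by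
  intro e
  apply h
  have : s • (q - p) = 0 := by
    have : s • (q - p) = ((1 - s) • p + s • q) - p := by module
    rw [this, e, sub_self]
  rcases smul_eq_zero.1 this with h | h
  · exact absurd h hs
  · exact (sub_eq_zero.1 h).symm

theorem combo_ne' {p q : ℝ × ℝ} {s : ℝ} (h : p ≠ q) (hs : s ≠ 1) : (1 - s) • p + s • q ≠ q := by
  have := combo_ne (s := 1 - s) h.symm (by intro e; apply hs; linarith)
  rw [sub_sub_cancel, add_comm] at this
  exact this

/-- Strict convexity says nothing about lists with two entries, so distinctness needs its own
argument: a later point lies strictly left of the edge line of the earlier one, unless it is on that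
same closed edge. -/
theorem clipPoint_ne (hn : L.Nodup) (h : StrictlyConvex L) {i j : ℕ} (hij : i < j)
    (hj : j < 2 * L.length) (Ki : ClipKeep a b L i) (Kj : ClipKeep a b L j) :
    clipPoint a b L i ≠ clipPoint a b L j := by
  have h2 : 2 ≤ L.length := by
    by_contra hc
    obtain rfl : j = 2 * 0 + 1 := by omega
    rw [clipKeep_odd] at Kj
    omega
  obtain ⟨s, hs0, hs1, hse, hso, es⟩ := clipPoint_eq Ki
  obtain ⟨t, ht0, ht1, hte, hto, et⟩ := clipPoint_eq Kj
  have hs1' : 0 < 1 - s := by linarith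
  have ht1' : 0 < 1 - t := by linarith
  have hne := vtx_succ_ne hn h2 (i := i / 2) (by omega)
  rcases Nat.lt_or_ge (i / 2) (j / 2) with c1 | c1
  · by_cases c2 : j / 2 = i / 2 + 1 ∧ j % 2 = 0
    · rw [es, et, hte c2.2, c2.1]
      simp only [sub_zero, one_smul, zero_smul, add_zero]
      exact combo_ne' hne hs1.ne
    · have h3 : 3 ≤ L.length := by
        by_contra hc
        obtain rfl : j = 2 * 1 + 1 := by omega
        rw [clipKeep_odd] at Kj
        omega
      intro e
      have e1 : planeOrient (vtx L (i / 2)) (vtx L (i / 2 + 1)) (clipPoint a b L i) = 0 := by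
        rw [es, planeOrient_combo₃, planeOrient_self₁₃, planeOrient_self₂₃]; ring
      rw [e, et, planeOrient_combo₃] at e1
      have hj' : j / 2 + 1 ≤ L.length := by omega
      have q1 := h.nonneg (i := i / 2) (j := i / 2 + 1) (k := j / 2) (by omega) (by omega)
        (by omega)
      have q2 := h.nonneg (i := i / 2) (j := i / 2 + 1) (k := j / 2 + 1) (by omega) (by omega)
        (by omega)
      revert e1
      apply ne_of_gt
      by_cases c3 : j / 2 = i / 2 + 1
      · have ht := hto (by omega)
        have q3 := h.pos (i := i / 2) (j := i / 2 + 1) (k := j / 2 + 1) (by omega) (by omega)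
          (by omega) (by omega)
        positivity
      · have q3 := h.pos (i := i / 2) (j := i / 2 + 1) (k := j / 2) (by omega) (by omega)
          (by omega) (by omega)
        positivity
  · have c3 : i / 2 = j / 2 := by omega
    rw [es, et, hse (by omega), ← c3]
    simp only [sub_zero, one_smul, zero_smul, add_zero]
    exact (combo_ne hne (hto (by omega)).ne').symm

theorem clip_nodup (hn : L.Nodup) (h : StrictlyConvex L) : (clip a b L).Nodup := by
  unfold clip clipPrefix
  rw [List.nodup_map_iff_inj_on (List.Nodup.filter _ List.nodup_range)]
  intro i hi j hj e
  simp only [List.mem_filter, List.mem_range, decide_eq_true_eq] at hi hj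
  rcases lt_trichotomy i j with c | c | c
  · exact absurd e (clipPoint_ne hn h c hj.1 hi.2 hj.2)
  · exact c
  · exact absurd e.symm (clipPoint_ne hn h c hi.1 hj.2 hi.2)

theorem clip_strictlyConvex (h : StrictlyConvex L) : StrictlyConvex (clip a b L) := by
  classical
  intro i j k hij hjk
  have hpw : ((List.range (2 * L.length)).filter fun i => ClipKeep a b L i).Pairwise (· < ·) :=
    List.pairwise_lt_range.filter _
  have hmem : ∀ i ∈ ((List.range (2 * L.length)).filter fun i => ClipKeep a b L i),
      i < 2 * L.length ∧ ClipKeep a b L i := by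
    intro i hi
    simpa using hi
  have hl : (clip a b L).length =
      ((List.range (2 * L.length)).filter fun i => ClipKeep a b L i).length := by
    simp [clip, clipPrefix]
  have hget : ∀ i : Fin (clip a b L).length, (clip a b L).get i = clipPoint a b L
      (((List.range (2 * L.length)).filter fun i => ClipKeep a b L i).get (i.cast hl)) := by
    intro i
    simp only [clip, clipPrefix]
    exact List.getElem_map (clipPoint a b L)
  rw [hget, hget, hget]
  generalize ((List.range (2 * L.length)).filter fun i => ClipKeep a b L i) = M at *
  have o1 := List.pairwise_iff_get.1 hpw (i.cast hl) (j.cast hl) hij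
  have o2 := List.pairwise_iff_get.1 hpw (j.cast hl) (k.cast hl) hjk
  have m1 := hmem _ (M.get_mem (i.cast hl))
  have m2 := hmem _ (M.get_mem (j.cast hl))
  have m3 := hmem _ (M.get_mem (k.cast hl))
  generalize M.get (i.cast hl) = i' at *
  generalize M.get (j.cast hl) = j' at *
  generalize M.get (k.cast hl) = k' at *
  rcases Nat.lt_or_ge L.length 3 with h3 | h3
  · exfalso
    -- Three positions on a segment include either the return edge, which is never kept, or both
    -- ends together with a crossing between them, which contradicts the signs.
    have c : k' = 2 * 1 + 1 ∨ (i' = 2 * 0 ∧ j' = 2 * 0 + 1 ∧ k' = 2 * (0 + 1)) := by omega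
    rcases c with rfl | ⟨rfl, rfl, rfl⟩
    · rw [clipKeep_odd] at m3
      omega
    · rw [clipKeep_odd] at m2
      rw [clipKeep_even] at m1 m3
      exact absurd m2.2.1 (not_lt.2 (mul_nonneg m1.2 m3.2))
  · exact clip_orient_pos h h3 o1 o2 m3.1 m1.2 m2.2 m3.2

end clip

/-! ### The region described by the clipped list -/

section clipHull

variable {a b : ℝ × ℝ} {L : List (ℝ × ℝ)}

/-- The hypothesis `p n → p 0` closes the cycle. Applied to both signs of the orientation, this
yields the edges where the boundary leaves and enters the half-plane. -/
theorem exists_cyclic_change {n : ℕ} {p : ℕ → Prop} (hp : p n → p 0) {i j : ℕ} (hi : i < n)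
    (hj : j < n) (pi : p i) (pj : ¬ p j) : ∃ k < n, p k ∧ ¬ p (k + 1) := by
  by_contra! hc
  have up : ∀ i, p i → ∀ d, i + d ≤ n → p (i + d) := by
    intro i pi d
    induction d with
    | zero => exact fun _ => pi
    | succ d ih => exact fun h => hc (i + d) (by omega) (ih (by omega))
  have h0 := hp (by simpa [show i + (n - i) = n by omega] using up i pi (n - i) (by omega))
  exact pj (by simpa using up 0 h0 j (by omega))

theorem vtx_mem_clip {i : ℕ} (hi : i < L.length) (h : 0 ≤ planeOrient a b (vtx L i)) :
    vtx L i ∈ clip a b L :=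
  mem_clip.2 ⟨2 * i, by omega, by simpa using h, by simp⟩

/-- If an end of the edge lies on the clipping line, no crossing is recorded, but the crossing point
equals that end, which survives as a vertex. Weak inequalities are therefore enough. -/
theorem crossPoint_mem_clip {i : ℕ} (hi : i < L.length) (h2 : i + 1 < L.length ∨ 2 < L.length)
    (h : (0 ≤ planeOrient a b (vtx L i) ∧ planeOrient a b (vtx L (i + 1)) < 0) ∨
      (planeOrient a b (vtx L i) < 0 ∧ 0 ≤ planeOrient a b (vtx L (i + 1)))) :
    crossPoint a b (vtx L i) (vtx L (i + 1)) ∈ clip a b L := by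
  by_cases hlt : planeOrient a b (vtx L i) * planeOrient a b (vtx L (i + 1)) < 0
  · exact mem_clip.2 ⟨2 * i + 1, by omega, by simpa using ⟨hlt, h2⟩, by simp⟩
  rcases h with ⟨h, h'⟩ | ⟨h, h'⟩
  · have e : planeOrient a b (vtx L i) = 0 := by
      by_contra hne
      exact hlt (mul_neg_of_pos_of_neg (lt_of_le_of_ne h (Ne.symm hne)) h')
    have : crossPoint a b (vtx L i) (vtx L (i + 1)) = vtx L i := by
      simp [crossPoint, e]
    rw [this]
    exact vtx_mem_clip hi h
  · have e : planeOrient a b (vtx L (i + 1)) = 0 := by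
      by_contra hne
      exact hlt (mul_neg_of_neg_of_pos h (lt_of_le_of_ne h' (Ne.symm hne)))
    have : crossPoint a b (vtx L i) (vtx L (i + 1)) = vtx L (i + 1) := by
      simp [crossPoint, e, div_self h.ne]
    rw [this]
    rcases Nat.lt_or_ge (i + 1) L.length with h1 | h1
    · exact vtx_mem_clip h1 h'
    · rw [show i + 1 = L.length by omega, vtx_length] at h' ⊢
      exact vtx_mem_clip (by omega) h'

theorem exists_eq_add_smul {x y : ℝ × ℝ} (hab : a ≠ b) (hx : planeOrient a b x = 0)
    (hy : planeOrient a b y = 0) : ∃ τ : ℝ, y = x + τ • (b - a) := by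
  have hN : (b.1 - a.1) ^ 2 + (b.2 - a.2) ^ 2 ≠ 0 := by
    intro h
    apply hab
    have h1 : b.1 - a.1 = 0 := by nlinarith [sq_nonneg (b.1 - a.1), sq_nonneg (b.2 - a.2)]
    have h2 : b.2 - a.2 = 0 := by nlinarith [sq_nonneg (b.1 - a.1), sq_nonneg (b.2 - a.2)]
    exact Prod.ext (by linarith) (by linarith)
  refine ⟨((y.1 - x.1) * (b.1 - a.1) + (y.2 - x.2) * (b.2 - a.2)) /
    ((b.1 - a.1) ^ 2 + (b.2 - a.2) ^ 2), ?_⟩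
  unfold planeOrient at hx hy
  ext
  · simp only [Prod.fst_add, Prod.smul_fst, Prod.fst_sub, smul_eq_mul]
    field_simp
    linear_combination (-(b.2 - a.2)) * (hy - hx)
  · simp only [Prod.snd_add, Prod.smul_snd, Prod.snd_sub, smul_eq_mul]
    field_simp
    linear_combination (b.1 - a.1) * (hy - hx)

/-- The position, on the line `a b`, of a point of the polygon relative to the crossing of the
line with an edge. -/
theorem StrictlyConvex.crossPoint_offset (h : StrictlyConvex L) {i : ℕ} (hi : i < L.length)
    {z : ℝ × ℝ} (hz : z ∈ convexHull ℝ {p | p ∈ L}) (hz0 : planeOrient a b z = 0)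
    (hne : planeOrient a b (vtx L i) ≠ planeOrient a b (vtx L (i + 1))) :
    ∃ τ : ℝ, z = crossPoint a b (vtx L i) (vtx L (i + 1)) + τ • (b - a) ∧
      0 ≤ τ * (planeOrient a b (vtx L i) - planeOrient a b (vtx L (i + 1))) := by
  have hab : a ≠ b := by
    rintro rfl
    simp [planeOrient_self₁₂] at hne
  obtain ⟨τ, e⟩ := exists_eq_add_smul hab (planeOrient_crossPoint hne) hz0
  refine ⟨τ, e, ?_⟩
  have h1 := h.hull_edge_nonneg hi hz
  rw [e] at h1
  -- Along the direction `b - a`, the orientation with respect to the edge grows at the rate by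
  -- which the orientation with respect to `a b` drops along the edge.
  convert h1 using 1
  simp only [crossPoint]
  generalize planeOrient a b (vtx L i) / (planeOrient a b (vtx L i) -
    planeOrient a b (vtx L (i + 1))) = s
  simp only [planeOrient, Prod.fst_add, Prod.snd_add, Prod.smul_fst, Prod.smul_snd, Prod.fst_sub,
    Prod.snd_sub, smul_eq_mul]
  ring

theorem crossPoint_unique {p q z : ℝ × ℝ} (hz : z ∈ segment ℝ p q) (hz0 : planeOrient a b z = 0)
    (hne : planeOrient a b p ≠ planeOrient a b q) : z = crossPoint a b p q := by
  obtain ⟨s, t, hs, ht, hst, rfl⟩ := hz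
  obtain rfl : s = 1 - t := by linarith
  rw [planeOrient_combo₃] at hz0
  have hne' := sub_ne_zero.2 hne
  have : planeOrient a b p / (planeOrient a b p - planeOrient a b q) = t := by
    field_simp
    linarith
  ext <;> simp [crossPoint, this] <;> ring

/-- The chord of the polygon on the clipping line survives. -/
theorem StrictlyConvex.chord_subset (h : StrictlyConvex L) {i j : ℕ} (hi : i < L.length)
    (hj : j < L.length) (hi0 : 0 ≤ planeOrient a b (vtx L i))
    (hj0 : planeOrient a b (vtx L j) < 0) {z : ℝ × ℝ} (hz : z ∈ convexHull ℝ {p | p ∈ L})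
    (hz0 : planeOrient a b z = 0) : z ∈ convexHull ℝ {p | p ∈ clip a b L} := by
  have hij : i ≠ j := by
    rintro rfl
    exact absurd hi0 (not_le.2 hj0)
  rcases Nat.lt_or_ge 2 L.length with h2 | h2
  · obtain ⟨k, hk, k1, k2⟩ := exists_cyclic_change (p := fun k => 0 ≤ planeOrient a b (vtx L k))
      (n := L.length) (by rw [vtx_length]; exact id) hi hj hi0 (not_le.2 hj0)
    obtain ⟨l, hl, l1, l2⟩ := exists_cyclic_change (p := fun k => planeOrient a b (vtx L k) < 0)
      (n := L.length) (by rw [vtx_length]; exact id) hj hi hj0 (not_lt.2 hi0)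
    simp only [not_le, not_lt] at k1 k2 l1 l2
    have mk := subset_convexHull ℝ {p | p ∈ clip a b L}
      (crossPoint_mem_clip hk (Or.inr h2) (Or.inl ⟨k1, k2⟩))
    have ml := subset_convexHull ℝ {p | p ∈ clip a b L}
      (crossPoint_mem_clip hl (Or.inr h2) (Or.inr ⟨l1, l2⟩))
    obtain ⟨τ, e1, t1⟩ := h.crossPoint_offset hk hz hz0 (ne_of_gt (by linarith))
    obtain ⟨σ, e2, t2⟩ := h.crossPoint_offset hl hz hz0 (ne_of_lt (by linarith))
    -- The two offsets have opposite signs, so `z` lies between the exit and the entry crossing.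
    have hτ : 0 ≤ τ := nonneg_of_mul_nonneg_left t1 (by linarith)
    have hσ : σ ≤ 0 := by
      by_contra hc
      have := mul_neg_of_pos_of_neg (not_le.1 hc) (show planeOrient a b (vtx L l) -
        planeOrient a b (vtx L (l + 1)) < 0 by linarith)
      linarith
    generalize crossPoint a b (vtx L k) (vtx L (k + 1)) = D at *
    generalize crossPoint a b (vtx L l) (vtx L (l + 1)) = U at *
    rcases (show 0 ≤ τ - σ by linarith).eq_or_lt with h0 | h0
    · obtain rfl : τ = 0 := by linarith
      rw [e1]
      simpa using mk
    · have : z = (-σ / (τ - σ)) • D + (τ / (τ - σ)) • U := by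
        have h1 : -σ / (τ - σ) * τ + τ / (τ - σ) * σ = 0 := by ring
        have h2 : -σ / (τ - σ) + τ / (τ - σ) = 1 := by field_simp; ring
        rw [eq_sub_of_add_eq e1.symm, eq_sub_of_add_eq e2.symm]
        generalize -σ / (τ - σ) = u at *
        generalize τ / (τ - σ) = v at *
        calc z = (u + v) • z - (u * τ + v * σ) • (b - a) := by
              rw [h1, h2, one_smul, zero_smul, sub_zero]
          _ = _ := by module
      rw [this]
      exact convex_convexHull ℝ {p | p ∈ clip a b L} mk ml
        (div_nonneg (by linarith) h0.le) (div_nonneg hτ h0.le) (by field_simp; ring)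
  · have hn : L.length = 2 := by omega
    have hset : {p | p ∈ L} = {vtx L 0, vtx L 1} := by
      ext p
      simp only [Set.mem_ofPred_eq, Set.mem_insert_iff, Set.mem_singleton_iff]
      constructor
      · intro hp
        obtain ⟨k, hk, rfl⟩ := exists_vtx_eq hp
        obtain rfl | rfl : k = 0 ∨ k = 1 := by omega
        exacts [Or.inl rfl, Or.inr rfl]
      · rintro (rfl | rfl)
        exacts [vtx_mem (by omega) _, vtx_mem (by omega) _]
    rw [hset, convexHull_pair] at hz
    have hc : (0 ≤ planeOrient a b (vtx L 0) ∧ planeOrient a b (vtx L (0 + 1)) < 0) ∨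
        (planeOrient a b (vtx L 0) < 0 ∧ 0 ≤ planeOrient a b (vtx L (0 + 1))) := by
      obtain ⟨rfl, rfl⟩ | ⟨rfl, rfl⟩ : (i = 0 ∧ j = 1) ∨ (i = 1 ∧ j = 0) := by omega
      exacts [Or.inl ⟨hi0, hj0⟩, Or.inr ⟨hj0, hi0⟩]
    have hm := crossPoint_mem_clip (by omega) (by omega) hc
    rw [crossPoint_unique hz hz0 (by
      rcases hc with ⟨h, h'⟩ | ⟨h, h'⟩
      exacts [(h'.trans_le h).ne', (h.trans_le h').ne])]
    exact subset_convexHull ℝ _ hm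

/-- For the harder inclusion, `x` is placed on a segment from a point `p` of the hull of the
surviving vertices to a point `q` of the hull of the removed ones. This segment meets the clipping
line in a point of the chord, and `x` lies between `p` and that point. -/
theorem clip_hull (h : StrictlyConvex L) : convexHull ℝ {p | p ∈ clip a b L} =
    convexHull ℝ {p | p ∈ L} ∩ {x | 0 ≤ planeOrient a b x} := by
  have hvm : ∀ k < L.length, ∀ i, vtx L i ∈ convexHull ℝ {p | p ∈ L} := fun k hk i =>
    subset_convexHull ℝ _ (vtx_mem (by omega) i)
  apply Set.Subset.antisymm
  · refine convexHull_min (fun p hp => ?_)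
      ((convex_convexHull ℝ _).inter (convex_halfPlane a b))
    obtain ⟨k, hk, K, rfl⟩ := mem_clip.1 hp
    constructor
    · obtain ⟨s, hs0, hs1, -, -, e⟩ := clipPoint_eq K
      rw [e]
      exact convex_convexHull ℝ {p | p ∈ L} (hvm (k / 2) (by omega) _) (hvm (k / 2) (by omega) _)
        (by linarith) hs0 (by ring)
    · rcases Nat.even_or_odd' k with ⟨i, rfl | rfl⟩
      · simpa using K
      · rw [clipKeep_odd] at K
        simp only [clipPoint_odd, Set.mem_ofPred_eq]
        rw [planeOrient_crossPoint]
        intro e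
        rw [e] at K
        exact absurd K.1 (not_lt.2 (mul_self_nonneg _))
  · rintro x ⟨hx, hx0⟩
    simp only [Set.mem_ofPred_eq] at hx0
    by_cases hall : ∀ i < L.length, 0 ≤ planeOrient a b (vtx L i)
    · refine convexHull_mono (fun p hp => ?_) hx
      obtain ⟨i, hi, rfl⟩ := exists_vtx_eq hp
      exact vtx_mem_clip hi (hall i hi)
    push Not at hall
    obtain ⟨j, hj, hj0⟩ := hall
    have hcneg : Convex ℝ {x | planeOrient a b x < 0} := by
      intro x hx y hy s t hs ht hst
      simp only [Set.mem_ofPred_eq] at *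
      rw [planeOrient_combo a b x y hst]
      rcases hs.eq_or_lt with rfl | hs
      · obtain rfl : t = 1 := by linarith
        simpa using hy
      · nlinarith [mul_neg_of_pos_of_neg hs hx, mul_nonpos_of_nonneg_of_nonpos ht hy.le]
    have hsplit : {p | p ∈ L} = {p | p ∈ L ∧ 0 ≤ planeOrient a b p} ∪
        {p | p ∈ L ∧ planeOrient a b p < 0} := by
      ext p
      simp only [Set.mem_union, Set.mem_ofPred_eq]
      rw [← and_or_left]
      simp [le_or_gt]
    have hnegne : {p | p ∈ L ∧ planeOrient a b p < 0}.Nonempty :=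
      ⟨_, vtx_mem (by omega) j, hj0⟩
    rcases Set.eq_empty_or_nonempty {p | p ∈ L ∧ 0 ≤ planeOrient a b p} with hemp | hne
    · exfalso
      rw [hsplit, hemp, Set.empty_union] at hx
      exact absurd (convexHull_min (fun p hp => hp.2) hcneg hx) (not_lt.2 hx0)
    obtain ⟨v, hv, hv0⟩ := id hne
    obtain ⟨i, hi, rfl⟩ := exists_vtx_eq hv
    have hx' := hx
    rw [hsplit, convexHull_union hne hnegne, mem_convexJoin] at hx'
    obtain ⟨p, hp, q, hq, s, t, hs, ht, hst, e⟩ := hx'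
    obtain rfl : s = 1 - t := by linarith
    have hp0 : 0 ≤ planeOrient a b p :=
      convexHull_min (fun p hp => hp.2) (convex_halfPlane a b) hp
    have hq0 : planeOrient a b q < 0 := convexHull_min (fun p hp => hp.2) hcneg hq
    have hpL : p ∈ convexHull ℝ {p | p ∈ L} := convexHull_mono (fun p hp => hp.1) hp
    have hqL : q ∈ convexHull ℝ {p | p ∈ L} := convexHull_mono (fun p hp => hp.1) hq
    have hpc : p ∈ convexHull ℝ {p | p ∈ clip a b L} := by
      refine convexHull_mono (fun v hv => ?_) hp
      obtain ⟨i, hi, rfl⟩ := exists_vtx_eq hv.1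
      exact vtx_mem_clip hi hv.2
    rw [← e, planeOrient_combo₃] at hx0
    have hpq : 0 < planeOrient a b p - planeOrient a b q := by linarith
    rcases hp0.eq_or_lt with h0 | h0
    · obtain rfl : t = 0 := by
        rw [← h0] at hx0
        by_contra hc
        have := mul_neg_of_pos_of_neg (lt_of_le_of_ne ht (Ne.symm hc)) hq0
        linarith
      rw [← e]
      simpa using hpc
    · set u := planeOrient a b p / (planeOrient a b p - planeOrient a b q) with hu
      have hu0 : 0 < u := div_pos h0 hpq
      have hu1 : u ≤ 1 := by rw [hu, div_le_one hpq]; linarith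
      have htu : t ≤ u := by rw [hu, le_div_iff₀ hpq]; linarith
      have hz : planeOrient a b ((1 - u) • p + u • q) = 0 := by
        rw [planeOrient_combo₃, hu]
        field_simp
        ring
      have hzL : (1 - u) • p + u • q ∈ convexHull ℝ {p | p ∈ L} :=
        convex_convexHull ℝ {p | p ∈ L} hpL hqL (by linarith) hu0.le (by ring)
      have hzc := h.chord_subset hi hj hv0 hj0 hzL hz
      have : x = (1 - t / u) • p + (t / u) • ((1 - u) • p + u • q) := by
        rw [← e, smul_add, smul_smul, smul_smul, div_mul_cancel₀ t hu0.ne', ← add_assoc,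
          ← add_smul]
        congr 2
        field_simp
        ring
      rw [this]
      exact convex_convexHull ℝ {p | p ∈ clip a b L} hpc hzc
        (by rw [sub_nonneg, div_le_one hu0]; exact htu) (div_nonneg ht hu0.le) (by ring)

theorem IsVertexList.clip {S : Set (ℝ × ℝ)} (h : IsVertexList L S) (a b : ℝ × ℝ) :
    IsVertexList (clip a b L) (S ∩ {x | 0 ≤ planeOrient a b x}) :=
  ⟨clip_nodup h.1 h.2.1, clip_strictlyConvex h.2.1, by rw [clip_hull h.2.1, h.2.2]⟩

end clipHull

/-! ### Intersection with a second polygon, edge by edge -/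

/-- The polygon `L` clipped by the first `j` edge half-planes of the polygon `B`. -/
noncomputable def clipEdges (B L : List (ℝ × ℝ)) : ℕ → List (ℝ × ℝ)
  | 0 => L
  | j + 1 => clip (vtx B j) (vtx B (j + 1)) (clipEdges B L j)

theorem clipEdges_length_le (B L : List (ℝ × ℝ)) (j : ℕ) :
    (clipEdges B L j).length ≤ 2 ^ j * L.length := by
  induction j with
  | zero => simp [clipEdges]
  | succ j ih =>
    refine clip_length_le.trans ?_
    rw [pow_succ]
    linarith

theorem IsVertexList.clipEdges {L B : List (ℝ × ℝ)} {S : Set (ℝ × ℝ)} (h : IsVertexList L S)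
    (j : ℕ) : IsVertexList (clipEdges B L j)
      (S ∩ {x | ∀ i < j, 0 ≤ planeOrient (vtx B i) (vtx B (i + 1)) x}) := by
  induction j with
  | zero => simpa [_root_.clipEdges] using h
  | succ j ih =>
    have e : {x | ∀ i < j + 1, 0 ≤ planeOrient (vtx B i) (vtx B (i + 1)) x} =
        {x | ∀ i < j, 0 ≤ planeOrient (vtx B i) (vtx B (i + 1)) x} ∩
          {x | 0 ≤ planeOrient (vtx B j) (vtx B (j + 1)) x} := by
      ext x
      simp only [Set.mem_inter_iff, Set.mem_ofPred_eq, Nat.lt_succ_iff_lt_or_eq]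
      constructor
      · exact fun h => ⟨fun i hi => h i (Or.inl hi), h j (Or.inr rfl)⟩
      · rintro ⟨h2, h3⟩ i (hi | rfl)
        exacts [h2 i hi, h3]
    rw [e, ← Set.inter_assoc]
    exact ih.clip (vtx B j) (vtx B (j + 1))

/-- Three vertices are needed: the edge half-planes of a segment only cut out its line, and those of
a point or of the empty list give the whole plane. -/
theorem IsVertexList.eq_edgeHalfPlanes {B : List (ℝ × ℝ)} {T : Set (ℝ × ℝ)}
    (h : IsVertexList B T) (h3 : 3 ≤ B.length) :
    T = {x | ∀ i < B.length, 0 ≤ planeOrient (vtx B i) (vtx B (i + 1)) x} := by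
  obtain ⟨-, hc, rfl⟩ := h
  have hc : StrictlyConvex B := hc
  ext x
  exact ⟨fun hx i hi => hc.hull_edge_nonneg hi hx, fun hx => hc.mem_hull h3 hx⟩

theorem IsVertexList.inter {L B : List (ℝ × ℝ)} {S T : Set (ℝ × ℝ)} (hL : IsVertexList L S)
    (hB : IsVertexList B T) (h3 : 3 ≤ B.length) :
    IsVertexList (_root_.clipEdges B L B.length) (S ∩ T) := by
  rw [hB.eq_edgeHalfPlanes h3]
  exact hL.clipEdges B.length

/-! ### Bounds on the number of vertices -/

/-- An extreme point of a polyhedron is determined by the forms whose constraints are active. -/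
theorem length_le_of_extremePoints {ι κ : Type*} [Finite ι] [Fintype κ]
    {ℓ : κ → ℝ × ℝ →ₗ[ℝ] ℝ} {β : ι → κ → ℝ} {L : List (ℝ × ℝ)} (hn : L.Nodup)
    (hL : ∀ p ∈ L, p ∈ Set.extremePoints ℝ {x | ∀ i j, β i j ≤ ℓ j x}) :
    L.length ≤ 2 ^ Fintype.card κ := by
  classical
  rw [← List.toFinset_card_of_nodup hn, ← Fintype.card_finset, ← Finset.card_univ]
  refine Finset.card_le_card_of_injOn
    (fun p => Finset.univ.filter fun j => ∃ i, ℓ j p = β i j) (fun _ _ => Finset.mem_univ _) ?_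
  intro p hp q hq e
  have hp := mem_extremePoints.1 (hL p (by simpa using hp))
  have hq := (mem_extremePoints.1 (hL q (by simpa using hq))).1
  have e' : ∀ j, (∃ i, ℓ j p = β i j) ↔ ∃ i, ℓ j q = β i j := fun j => by
    simpa using Finset.ext_iff.1 e j
  -- Moving from `p` slightly away from `q` stays in the polyhedron: active forms agree at `p` and
  -- `q`, and the finitely many other constraints have slack. Then `p` is interior to a segment
  -- ending in `q`, which forces `p = q`.
  have hev : ∀ᶠ δ : ℝ in nhdsWithin 0 (Set.Ioi 0), ∀ i j, β i j ≤ ℓ j p + δ * (ℓ j p - ℓ j q) := by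
    rw [Filter.eventually_all]; intro i
    rw [Filter.eventually_all]; intro j
    by_cases hj : ∃ i, ℓ j p = β i j
    · obtain ⟨i₁, h1⟩ := hj
      obtain ⟨i₂, h2⟩ := (e' j).1 ⟨i₁, h1⟩
      have h3 := hq i₁ j
      have h4 := hp.1 i₂ j
      -- Both values are the largest bound `β i j` for this `j`, even if it is attained at different
      -- indices.
      have h5 : ℓ j p = ℓ j q := by linarith
      exact Filter.Eventually.of_forall fun δ => by
        rw [h5, sub_self, mul_zero, add_zero]; exact hq i j
    · have hlt : β i j < ℓ j p := lt_of_le_of_ne (hp.1 i j) fun h => hj ⟨i, h.symm⟩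
      have hc : Continuous fun δ : ℝ => ℓ j p + δ * (ℓ j p - ℓ j q) := by fun_prop
      have ht := hc.tendsto 0
      rw [zero_mul, add_zero] at ht
      exact ((ht.eventually (lt_mem_nhds hlt)).filter_mono nhdsWithin_le_nhds).mono
        fun δ h => h.le
  obtain ⟨δ, hδ, hδ0⟩ := (hev.and self_mem_nhdsWithin).exists
  have hδ0 : 0 < δ := hδ0
  refine (hp.2 (p + δ • (p - q)) (fun i j => ?_) q hq
    ⟨1 / (1 + δ), δ / (1 + δ), by positivity, by positivity, by field_simp, ?_⟩).2.symm
  · rw [map_add, map_smul, map_sub, smul_eq_mul]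
    exact hδ i j
  · have h1 : (1 / (1 + δ)) * δ = δ / (1 + δ) := by ring
    have h2 : 1 / (1 + δ) + δ / (1 + δ) = 1 := by field_simp
    rw [smul_add, smul_smul, h1]
    generalize δ / (1 + δ) = u at *
    obtain h3 : 1 / (1 + δ) = 1 - u := by linarith
    rw [h3]
    module

/-! ### Homothetic regular polygons and their numbers of vertices -/

theorem regularVertex_eq (m : ℕ) (c c' : ℝ × ℝ) {r : ℝ} (hr : r ≠ 0) (r' : ℝ) (j : ℕ) :
    c' + (r' / r) • (regularVertex m c r j - c) = regularVertex m c' r' j := by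
  ext <;> simp [regularVertex] <;> field_simp

theorem mem_regularPolygon_map {m : ℕ} {c : ℝ × ℝ} {r : ℝ} (hr : r ≠ 0) (c' : ℝ × ℝ) (r' : ℝ)
    {x : ℝ × ℝ} (hx : x ∈ regularPolygon m c r) :
    c' + (r' / r) • (x - c) ∈ regularPolygon m c' r' := by
  have hc : Convex ℝ {x | c' + (r' / r) • (x - c) ∈ regularPolygon m c' r'} := by
    intro x hx y hy s t hs ht hst
    have := convex_convexHull ℝ (regularVertex m c' r' '' Set.Icc 1 m) hx hy hs ht hst
    simp only [Set.mem_ofPred_eq, regularPolygon]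
    convert this using 1
    obtain rfl : s = 1 - t := by linarith
    module
  refine convexHull_min ?_ hc hx
  rintro _ ⟨j, hj, rfl⟩
  simp only [Set.mem_ofPred_eq]
  rw [regularVertex_eq m c c' hr]
  exact subset_convexHull ℝ _ ⟨j, hj, rfl⟩

theorem mem_regularPolygon_iff {m : ℕ} {c c' : ℝ × ℝ} {r r' : ℝ} (hr : 0 < r) (hr' : 0 < r')
    {x : ℝ × ℝ} :
    x ∈ regularPolygon m c r ↔ c' + (r' / r) • (x - c) ∈ regularPolygon m c' r' := by
  refine ⟨mem_regularPolygon_map hr.ne' c' r', fun h => ?_⟩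
  have := mem_regularPolygon_map hr'.ne' c r h
  rwa [add_sub_cancel_left, smul_smul, div_mul_div_cancel₀ hr'.ne', div_self hr.ne', one_smul,
    add_sub_cancel] at this

theorem regularPolygon_length_le {m : ℕ} {c : ℝ × ℝ} {r : ℝ} {B : List (ℝ × ℝ)}
    (hB : IsVertexList B (regularPolygon m c r)) : B.length ≤ m := by
  classical
  rw [← List.toFinset_card_of_nodup hB.1]
  have hsub : B.toFinset ⊆ (Finset.Icc 1 m).image (regularVertex m c r) := by
    intro p hp
    have := extremePoints_convexHull_subset (hB.mem_extremePoints (List.mem_toFinset.1 hp))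
    simpa using this
  exact (Finset.card_le_card hsub).trans (Finset.card_image_le.trans (by simp))

/-- With θ = 2π/m the orientation equals 2r² sin θ (1 - cos θ), and 0 < θ < π because m ≥ 3. -/
theorem regularVertex_orient_pos {m : ℕ} (hm : 3 ≤ m) (c : ℝ × ℝ) {r : ℝ} (hr : 0 < r) :
    0 < planeOrient (regularVertex m c r 1) (regularVertex m c r 2) (regularVertex m c r 3) := by
  have hm0 : (3 : ℝ) ≤ m := by exact_mod_cast hm
  have hpi := Real.pi_pos
  have e3 : ((((3 : ℕ) : ℝ) - 1) / m * (2 * Real.pi)) = 2 * (1 / m * (2 * Real.pi)) := by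
    push_cast; ring
  have e2 : ((((2 : ℕ) : ℝ) - 1) / m * (2 * Real.pi)) = 1 / m * (2 * Real.pi) := by
    push_cast; ring
  have h0 : 0 < 1 / (m : ℝ) * (2 * Real.pi) := by positivity
  have h1 : 1 / (m : ℝ) * (2 * Real.pi) < Real.pi := by
    rw [one_div_mul_eq_div, div_lt_iff₀ (by linarith)]
    nlinarith
  have hs := Real.sin_pos_of_pos_of_lt_pi h0 h1
  have hsc := Real.sin_sq_add_cos_sq (1 / (m : ℝ) * (2 * Real.pi))
  have hc : Real.cos (1 / (m : ℝ) * (2 * Real.pi)) < 1 := by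
    nlinarith
  unfold regularVertex planeOrient
  rw [e2, e3, Real.sin_two_mul, Real.cos_two_mul]
  simp only [Nat.cast_one, sub_self, zero_div, zero_mul, Real.cos_zero, Real.sin_zero]
  generalize Real.sin (1 / (m : ℝ) * (2 * Real.pi)) = S at *
  generalize Real.cos (1 / (m : ℝ) * (2 * Real.pi)) = C at *
  have : 0 < 2 * r ^ 2 * S * (1 - C) := by
    have : 0 < 1 - C := by linarith
    positivity
  convert this using 1
  ring

theorem regularPolygon_three_le {m : ℕ} (hm : 3 ≤ m) {c : ℝ × ℝ} {r : ℝ} (hr : 0 < r)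
    {B : List (ℝ × ℝ)} (hB : IsVertexList B (regularPolygon m c r)) : 3 ≤ B.length := by
  by_contra hc
  have hmem : ∀ j, 1 ≤ j → j ≤ m → regularVertex m c r j ∈ convexHull ℝ {p | p ∈ B} := by
    intro j h1 h2
    rw [hB.2.2]
    exact subset_convexHull ℝ _ ⟨j, ⟨h1, h2⟩, rfl⟩
  -- Cyclic reading makes this valid for lengths 0, 1 and 2 alike, so the polygon would lie on a
  -- line or be a point, against the orientation of its first three vertices.
  have hseg : {p | p ∈ B} ⊆ {vtx B 0, vtx B 1} := by
    intro p hp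
    obtain ⟨k, hk, rfl⟩ := exists_vtx_eq hp
    obtain rfl | rfl : k = 0 ∨ k = 1 := by omega
    exacts [Or.inl rfl, Or.inr rfl]
  have hmem2 : ∀ j, 1 ≤ j → j ≤ m → ∃ t : ℝ,
      regularVertex m c r j = (1 - t) • vtx B 0 + t • vtx B 1 := by
    intro j h1 h2
    have := convexHull_mono hseg (hmem j h1 h2)
    rw [convexHull_pair] at this
    obtain ⟨s, t, -, -, hst, e⟩ := this
    exact ⟨t, by rw [← e, ← hst, add_sub_cancel_right]⟩
  obtain ⟨t₁, e1⟩ := hmem2 1 (by omega) (by omega)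
  obtain ⟨t₂, e2⟩ := hmem2 2 (by omega) (by omega)
  obtain ⟨t₃, e3⟩ := hmem2 3 (by omega) (by omega)
  have h := regularVertex_orient_pos hm c hr
  rw [e1, e2, e3] at h
  simp only [planeOrient_combo₁, planeOrient_combo₂, planeOrient_combo₃, planeOrient_self₁₂,
    planeOrient_self₁₃, planeOrient_self₂₃] at h
  linarith

theorem coneRadius_pos {n : ℕ} {P : ℕ → DataPoint} (hP : IsTrajectory n P) {s i : ℕ}
    (hi : 1 ≤ i) (hin : s + i ≤ n) {ε tc : ℝ} (hε : 0 < ε) (htc : (P s).t < tc) :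
    0 < coneRadius (P s) (P (s + i)) ε tc := by
  have := hP s (s + i) (by omega) hin
  exact mul_pos (div_pos (by linarith) (by linarith)) hε

theorem inscribedIntersection_length_le {m n : ℕ} (hm : 3 ≤ m) {P : ℕ → DataPoint}
    (hP : IsTrajectory n P) {s l : ℕ} (hl : s + (l + 1) ≤ n) {ε tc : ℝ} (hε : 0 < ε)
    (htc : (P s).t < tc) {A B : List (ℝ × ℝ)}
    (hA : IsVertexList A (inscribedIntersection m P s ε tc l))
    (hB : IsVertexList B (inscribedPolygon m P s ε tc (l + 1))) : A.length ≤ 2 ^ m := by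
  have hr' := coneRadius_pos hP (i := l + 1) (by omega) hl hε htc
  have h3 := regularPolygon_three_le hm hr' hB
  have hBm := regularPolygon_length_le hB
  refine le_trans ?_ (Nat.pow_le_pow_right two_pos hBm)
  set c' := coneCenter (P s) (P (s + (l + 1))) tc
  set r' := coneRadius (P s) (P (s + (l + 1))) ε tc
  let c : Set.Icc 1 l → ℝ × ℝ := fun i => coneCenter (P s) (P (s + i)) tc
  let r : Set.Icc 1 l → ℝ := fun i => coneRadius (P s) (P (s + i)) ε tc
  let F : Fin B.length → ℝ × ℝ →ₗ[ℝ] ℝ := fun j => edgeForm (vtx B j) (vtx B (j + 1))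
  -- The homothety from polygon `i` to polygon `l + 1` pulls the constraint of edge `j` of `B` back
  -- to one with the same form and a shifted bound. Taking the forms from `B` avoids computing the
  -- normals of the regular polygon.
  have key : inscribedIntersection m P s ε tc l =
      {x | ∀ (i : Set.Icc 1 l) (j : Fin B.length),
        F j (c i) + (r i / r') * (F j (vtx B j) - F j c') ≤ F j x} := by
    ext x
    simp only [inscribedIntersection, Set.mem_iInter, Set.mem_ofPred_eq, Subtype.forall]
    refine forall₂_congr fun i hi => ?_
    have hri : 0 < coneRadius (P s) (P (s + i)) ε tc :=
      coneRadius_pos hP hi.1 (by have := hi.2; omega) hε htc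
    rw [inscribedPolygon, mem_regularPolygon_iff hri hr' (c' := c')]
    change _ ∈ inscribedPolygon m P s ε tc (l + 1) ↔ _
    rw [hB.eq_edgeHalfPlanes h3]
    simp only [Set.mem_ofPred_eq, Fin.forall_iff]
    refine forall₂_congr fun j hj => ?_
    rw [planeOrient_eq_edgeForm]
    simp only [map_add, map_smul, map_sub, smul_eq_mul, F, c, r]
    generalize coneRadius (P s) (P (s + i)) ε tc = ρ at *
    generalize edgeForm (vtx B j) (vtx B (j + 1)) (vtx B j) = y1
    generalize edgeForm (vtx B j) (vtx B (j + 1)) x = y2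
    generalize edgeForm (vtx B j) (vtx B (j + 1)) c' = y3
    generalize edgeForm (vtx B j) (vtx B (j + 1)) (coneCenter (P s) (P (s + i)) tc) = y4
    have e : ρ / r' * (y3 + r' / ρ * (y2 - y4) - y1) = y2 - (y4 + ρ / r' * (y1 - y3)) := by
      field_simp
      ring
    rw [← sub_nonneg (b := y4 + _), ← e, mul_nonneg_iff_of_pos_left (by positivity)]
  have := length_le_of_extremePoints hA.1 (fun p hp => key ▸ hA.mem_extremePoints hp)
  simpa using this

/-! ### Reasoning about programs -/

namespace RealRAM

/-- Programs without loops. -/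
def Prog.LoopFree : Prog → Prop
  | skip => True
  | setInt _ _ => True
  | setReal _ _ => True
  | write _ _ _ => True
  | seq p q => p.LoopFree ∧ q.LoopFree
  | branch _ p q => p.LoopFree ∧ q.LoopFree
  | loop _ _ => False

open Classical in
/-- The final state of a loop-free program. -/
noncomputable def Prog.run : Prog → State → State
  | skip, σ => σ
  | setInt x e, σ => σ.setInt x (e.eval σ)
  | setReal x e, σ => σ.setReal x (e.eval σ)
  | write a i e, σ => σ.write a (i.eval σ) (e.eval σ)
  | seq p q, σ => q.run (p.run σ)
  | branch b p q, σ => if b.Holds σ then p.run σ else q.run σ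
  | loop _ _, σ => σ

/-- A bound on the running time of a loop-free program. -/
def Prog.maxCost : Prog → ℕ
  | skip => 1
  | setInt _ e => e.cost + 1
  | setReal _ e => e.cost + 1
  | write _ i e => i.cost + e.cost + 1
  | seq p q => p.maxCost + q.maxCost
  | branch b p q => b.cost + p.maxCost + q.maxCost
  | loop _ _ => 0

/-- Started in `σ`, the program `p` halts within `c` steps in a state satisfying `Q`. -/
def Runs (p : Prog) (σ : State) (c : ℕ) (Q : State → Prop) : Prop :=
  ∃ t τ, t ≤ c ∧ Exec p σ t τ ∧ Q τ

theorem Prog.LoopFree.exec {p : Prog} (h : p.LoopFree) (σ : State) :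
    ∃ t ≤ p.maxCost, Exec p σ t (p.run σ) := by
  induction p generalizing σ with
  | skip => exact ⟨1, le_rfl, Exec.skip σ⟩
  | setInt x e => exact ⟨_, le_rfl, Exec.setInt σ x e⟩
  | setReal x e => exact ⟨_, le_rfl, Exec.setReal σ x e⟩
  | write a i e => exact ⟨_, le_rfl, Exec.write σ a i e⟩
  | seq p q ihp ihq =>
    obtain ⟨t, ht, hp⟩ := ihp h.1 σ
    obtain ⟨u, hu, hq⟩ := ihq h.2 (p.run σ)
    exact ⟨t + u, add_le_add ht hu, hp.seq hq⟩
  | branch b p q ihp ihq =>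
    simp only [Prog.run, Prog.maxCost]
    split_ifs with hb
    · obtain ⟨t, ht, hp⟩ := ihp h.1 σ
      exact ⟨_, by omega, Exec.branchTrue hb hp⟩
    · obtain ⟨t, ht, hq⟩ := ihq h.2 σ
      exact ⟨_, by omega, Exec.branchFalse hb hq⟩
  | loop b p => exact h.elim

theorem Prog.LoopFree.runs {p : Prog} (h : p.LoopFree) {σ : State} {Q : State → Prop}
    (hQ : Q (p.run σ)) : Runs p σ p.maxCost Q := by
  obtain ⟨t, ht, e⟩ := h.exec σ
  exact ⟨t, _, ht, e, hQ⟩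

theorem Runs.mono {p : Prog} {σ : State} {c d : ℕ} {Q R : State → Prop} (h : Runs p σ c Q)
    (hcd : c ≤ d) (hQR : ∀ τ, Q τ → R τ) : Runs p σ d R := by
  obtain ⟨t, τ, ht, e, hQ⟩ := h
  exact ⟨t, τ, ht.trans hcd, e, hQR τ hQ⟩

theorem Runs.seq {p q : Prog} {σ : State} {c d : ℕ} {Q R : State → Prop} (h : Runs p σ c Q)
    (hq : ∀ τ, Q τ → Runs q τ d R) : Runs (p.seq q) σ (c + d) R := by
  obtain ⟨t, τ, ht, e, hQ⟩ := h
  obtain ⟨u, υ, hu, e', hR⟩ := hq τ hQ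
  exact ⟨t + u, υ, add_le_add ht hu, e.seq e', hR⟩

/-- The invariant is indexed by the number of completed passes, and the loop makes exactly `N` of
them; the extra `b.cost` pays for the final failing test. -/
theorem Runs.loop {b : Test} {p : Prog} {c N : ℕ} (I : ℕ → State → Prop)
    (hstep : ∀ k < N, ∀ σ, I k σ → b.Holds σ ∧ Runs p σ c (I (k + 1)))
    (hexit : ∀ σ, I N σ → ¬ b.Holds σ) {σ : State} (h0 : I 0 σ) :
    Runs (p.loop b) σ (N * (b.cost + c) + b.cost) (I N) := by
  have key : ∀ d k σ, k + d = N → I k σ →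
      Runs (p.loop b) σ (d * (b.cost + c) + b.cost) (I N) := by
    intro d
    induction d with
    | zero =>
      rintro k σ rfl hI
      exact ⟨_, σ, by simp, Exec.loopStop (hexit σ hI), hI⟩
    | succ d ih =>
      intro k σ hk hI
      obtain ⟨hb, t, τ, ht, e, hI'⟩ := hstep k (by omega) σ hI
      obtain ⟨u, υ, hu, e', hN⟩ := ih (k + 1) τ (by omega) hI'
      exact ⟨_, υ, by rw [Nat.succ_mul]; omega, Exec.loopStep hb e e', hN⟩
  exact key N 0 σ (by omega) h0

/-! ### Stored lists -/

/-- Append a point to the list in slot `q`. -/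
noncomputable def State.push (σ : State) (q : ℕ) (p : ℝ × ℝ) : State :=
  ((σ.write (2 * q) (σ.int q) p.1).write (2 * q + 1) (σ.int q) p.2).setInt q (σ.int q + 1)

/-- The states agree except for slot `q`, the counters `4` and `6` and the real variables. -/
def AgreeOff (q : ℕ) (σ τ : State) : Prop :=
  (∀ x, x ≠ q → x ≠ 4 → x ≠ 6 → τ.int x = σ.int x) ∧
    ∀ c, c ≠ 2 * q → c ≠ 2 * q + 1 → τ.arr c = σ.arr c

theorem AgreeOff.refl (q : ℕ) (σ : State) : AgreeOff q σ σ :=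
  ⟨fun _ _ _ _ => rfl, fun _ _ _ => rfl⟩

theorem AgreeOff.trans {q : ℕ} {σ τ υ : State} (h : AgreeOff q σ τ) (h' : AgreeOff q τ υ) :
    AgreeOff q σ υ :=
  ⟨fun x h1 h2 h3 => (h'.1 x h1 h2 h3).trans (h.1 x h1 h2 h3),
    fun c h1 h2 => (h'.2 c h1 h2).trans (h.2 c h1 h2)⟩

theorem AgreeOff.push {q : ℕ} {σ τ : State} (h : AgreeOff q σ τ) (p : ℝ × ℝ) :
    AgreeOff q σ (τ.push q p) := by
  refine h.trans ⟨fun x hx _ _ => ?_, fun c h1 h2 => ?_⟩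
  · simp [State.push, State.setInt, State.write, hx]
  · simp [State.push, State.setInt, State.write, h1, h2]

theorem AgreeOff.setInt {q : ℕ} {σ τ : State} (h : AgreeOff q σ τ) {x : ℕ}
    (hx : x = q ∨ x = 4 ∨ x = 6) (v : ℕ) : AgreeOff q σ (τ.setInt x v) := by
  refine h.trans ⟨fun y h1 h2 h3 => ?_, fun c h1 h2 => rfl⟩
  have : y ≠ x := by rintro rfl; omega
  simp [State.setInt, this]

theorem Stores.of_eq {σ τ : State} {q : ℕ} {L : List (ℝ × ℝ)} (h : Stores σ q L)
    (hi : τ.int q = σ.int q) (ha : τ.arr = σ.arr) : Stores τ q L := by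
  unfold Stores
  rw [hi, ha]
  exact h

theorem Stores.of_agreeOff {σ τ : State} {q q' : ℕ} {L : List (ℝ × ℝ)} (h : Stores σ q L)
    (hA : AgreeOff q' σ τ) (hq : q ≠ q') (h4 : q ≠ 4) (h6 : q ≠ 6) : Stores τ q L := by
  unfold Stores
  rw [hA.1 q hq h4 h6, hA.2 _ (by omega) (by omega), hA.2 _ (by omega) (by omega)]
  exact h

theorem Stores.arr_eq {σ : State} {q : ℕ} {L : List (ℝ × ℝ)} (h : Stores σ q L) {i : ℕ}
    (hi : i < L.length) :
    σ.arr (2 * q) i = (vtx L i).1 ∧ σ.arr (2 * q + 1) i = (vtx L i).2 := by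
  rw [vtx_eq_getElem hi]
  exact h.2 ⟨i, hi⟩

theorem Stores.nil {σ : State} {q : ℕ} (h : σ.int q = 0) : Stores σ q [] :=
  ⟨by simpa using h, fun i => i.elim0⟩

theorem Stores.push {σ : State} {q : ℕ} {L : List (ℝ × ℝ)} (h : Stores σ q L) (p : ℝ × ℝ) :
    Stores (σ.push q p) q (L ++ [p]) := by
  refine ⟨by simp [State.push, State.setInt, State.write, h.1], ?_⟩
  rintro ⟨i, hi⟩
  rw [List.length_append, List.length_singleton] at hi
  simp only [State.push, State.setInt, State.write, h.1, List.get_eq_getElem]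
  rcases Nat.lt_or_ge i L.length with h1 | h1
  · rw [List.getElem_append_left h1]
    have := h.2 ⟨i, h1⟩
    simpa [Function.update_apply, h1.ne] using this
  · obtain rfl : i = L.length := by omega
    simp

/-- The machine has no remainder operation, so programs find the cyclic successor by a comparison.
-/
theorem vtx_next {L : List (ℝ × ℝ)} {i : ℕ} (hi : i < L.length) :
    vtx L (if i + 1 < L.length then i + 1 else 0) = vtx L (i + 1) := by
  split_ifs with h
  · rfl
  · rw [show i + 1 = L.length by omega, vtx_length]

/-! ### The programs -/

/-- Append the point with coordinates in the real variables `x` and `y` to slot `q`. -/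
def pushProg (q x y : ℕ) : Prog :=
  .seq (.write (2 * q) (.var q) (.var x))
    (.seq (.write (2 * q + 1) (.var q) (.var y)) (.setInt q (.add (.var q) (.const 1))))

theorem run_pushProg (q x y : ℕ) (σ : State) :
    (pushProg q x y).run σ = σ.push q (σ.real x, σ.real y) := rfl

/-- Increment the integer variable `x`. -/
def incr (x : ℕ) : Prog := .setInt x (.add (.var x) (.const 1))

/-- Copy the entry of slot `q` with index `i` to slot `q'`, and advance the index. -/
def copyBody (q q' : ℕ) : Prog :=
  .seq (.setReal 4 (.read (2 * q) (.var 4))) (.seq (.setReal 5 (.read (2 * q + 1) (.var 4)))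
    (.seq (pushProg q' 4 5) (incr 4)))

/-- Copy the list in slot `q` to slot `q'`. -/
def copyProg (q q' : ℕ) : Prog :=
  .seq (.seq (.setInt q' (.const 0)) (.setInt 4 (.const 0)))
    (.loop (.intLt (.var 4) (.var q)) (copyBody q q'))

theorem run_copyBody (q q' : ℕ) (σ : State) :
    (copyBody q q').run σ = (incr 4).run
      (((σ.setReal 4 (σ.arr (2 * q) (σ.int 4))).setReal 5 (σ.arr (2 * q + 1) (σ.int 4))).push q'
        (σ.arr (2 * q) (σ.int 4), σ.arr (2 * q + 1) (σ.int 4))) := by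
  unfold copyBody
  simp only [Prog.run, run_pushProg]
  simp [State.setReal, RExpr.eval, IExpr.eval, incr]

/-- A time bound for copying a list of length `N`. -/
def copyCost (q q' N : ℕ) : ℕ :=
  (Prog.seq (.setInt q' (.const 0)) (.setInt 4 (.const 0))).maxCost +
    (N * ((Test.intLt (.var 4) (.var q)).cost + (copyBody q q').maxCost) +
      (Test.intLt (.var 4) (.var q)).cost)

theorem copyCost_mono (q q' : ℕ) {M N : ℕ} (h : M ≤ N) : copyCost q q' M ≤ copyCost q q' N := by
  unfold copyCost
  gcongr

theorem runs_copyProg {q q' : ℕ} (hq : q ≠ q') (hq4 : q ≠ 4) (hq6 : q ≠ 6) (hq4' : q' ≠ 4)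
    {σ : State} {L : List (ℝ × ℝ)} (h : Stores σ q L) :
    Runs (copyProg q q') σ (copyCost q q' L.length)
      (fun τ => Stores τ q' L ∧ AgreeOff q' σ τ) := by
  have hinit : Prog.LoopFree (.seq (.setInt q' (.const 0)) (.setInt 4 (.const 0))) :=
    ⟨trivial, trivial⟩
  have hbody : (copyBody q q').LoopFree := by
    simp [copyBody, pushProg, incr, Prog.LoopFree]
  refine (hinit.runs (Q := fun τ => Stores τ q' [] ∧ AgreeOff q' σ τ ∧ τ.int 4 = 0) ?_).seq
    fun τ hτ => ?_
  · refine ⟨Stores.nil ?_, ?_, ?_⟩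
    · simp [Prog.run, State.setInt, IExpr.eval, hq4']
    · exact ((AgreeOff.refl q' σ).setInt (Or.inl rfl) _).setInt (Or.inr (Or.inl rfl)) _
    · simp [Prog.run, State.setInt, IExpr.eval]
  · refine (Runs.loop (N := L.length) (fun k τ => Stores τ q' (L.take k) ∧ AgreeOff q' σ τ ∧
      τ.int 4 = k) ?_ ?_ (σ := τ) ?_).mono le_rfl ?_
    · rintro k hk υ ⟨h1, h2, h3⟩
      have hs := h.of_agreeOff h2 hq hq4 hq6
      refine ⟨by simpa [Test.Holds, IExpr.eval, h3, hs.1] using hk, hbody.runs ?_⟩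
      rw [run_copyBody, h3, (hs.arr_eq hk).1, (hs.arr_eq hk).2]
      set υ' := (υ.setReal 4 (vtx L k).1).setReal 5 (vtx L k).2 with hυ'
      have h1' : Stores υ' q' (L.take k) := h1.of_eq rfl rfl
      have h2' : AgreeOff q' σ υ' := h2
      refine ⟨?_, ?_, ?_⟩
      · have := (h1'.push (vtx L k)).of_eq (τ := (incr 4).run (υ'.push q' (vtx L k)))
          (by simp [incr, Prog.run, State.setInt, hq4']) rfl
        rw [vtx_eq_getElem hk, List.take_append_getElem, ← vtx_eq_getElem hk] at this
        exact this
      · exact (h2'.push _).setInt (Or.inr (Or.inl rfl)) _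
      · have h3' : υ'.int 4 = k := h3
        simp [incr, Prog.run, State.setInt, State.push, State.write, IExpr.eval, h3', hq4'.symm]
    · rintro υ ⟨-, h2, h3⟩
      have hs := h.of_agreeOff h2 hq hq4 hq6
      simp [Test.Holds, IExpr.eval, h3, hs.1]
    · simpa using hτ
    · rintro υ ⟨h1, h2, -⟩
      rw [List.take_length] at h1
      exact ⟨h1, h2⟩

/-- Set the integer variable `6` to the cyclic successor of index `x` in slot `q`. -/
def nextProg (x q : ℕ) : Prog :=
  .branch (.intLt (.add (.var x) (.const 1)) (.var q)) (.setInt 6 (.add (.var x) (.const 1)))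
    (.setInt 6 (.const 0))

theorem run_nextProg (x q : ℕ) (σ : State) :
    (nextProg x q).run σ = σ.setInt 6 (if σ.int x + 1 < σ.int q then σ.int x + 1 else 0) := by
  by_cases h : σ.int x + 1 < σ.int q <;> simp [nextProg, Prog.run, Test.Holds, IExpr.eval, h]

/-- `planeOrient` of the points in the real variables `0, 1` and `2, 3` and `x, y`. -/
def orientExpr (x y : ℕ) : RExpr :=
  .sub (.mul (.sub (.var 2) (.var 0)) (.sub (.var y) (.var 1)))
    (.mul (.sub (.var 3) (.var 1)) (.sub (.var x) (.var 0)))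

/-- A coordinate of the crossing point. -/
def crossExpr (x y : ℕ) : RExpr :=
  .add (.var x) (.mul (.div (.var 8) (.sub (.var 8) (.var 9))) (.sub (.var y) (.var x)))

/-- Load an edge of the list in slot `2`, evaluate the half-plane at its end points and compute
the crossing point. -/
def loadProg : Prog :=
  .seq (nextProg 4 2)
  (.seq (.setReal 4 (.read 4 (.var 4)))
  (.seq (.setReal 5 (.read 5 (.var 4)))
  (.seq (.setReal 6 (.read 4 (.var 6)))
  (.seq (.setReal 7 (.read 5 (.var 6)))
  (.seq (.setReal 8 (orientExpr 4 5))
  (.seq (.setReal 9 (orientExpr 6 7))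
  (.seq (.setReal 10 (crossExpr 4 6))
  (.setReal 11 (crossExpr 5 7)))))))))

theorem run_loadProg {σ : State} {L : List (ℝ × ℝ)} (h : Stores σ 2 L) {i : ℕ}
    (hi : i < L.length) (h4 : σ.int 4 = i) {a b : ℝ × ℝ} (h0 : σ.real 0 = a.1)
    (h1 : σ.real 1 = a.2) (h2 : σ.real 2 = b.1) (h3 : σ.real 3 = b.2) :
    ((loadProg.run σ).arr = σ.arr ∧ ∀ x, x ≠ 6 → (loadProg.run σ).int x = σ.int x) ∧
    ((loadProg.run σ).real 0 = a.1 ∧ (loadProg.run σ).real 1 = a.2 ∧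
      (loadProg.run σ).real 2 = b.1 ∧ (loadProg.run σ).real 3 = b.2) ∧
    ((loadProg.run σ).real 4, (loadProg.run σ).real 5) = vtx L i ∧
    (loadProg.run σ).real 8 = planeOrient a b (vtx L i) ∧
    (loadProg.run σ).real 9 = planeOrient a b (vtx L (i + 1)) ∧
    ((loadProg.run σ).real 10, (loadProg.run σ).real 11) =
      crossPoint a b (vtx L i) (vtx L (i + 1)) := by
  have hj : (if i + 1 < L.length then i + 1 else 0) < L.length := by split_ifs <;> omega
  have e1 := h.arr_eq hi
  have e2 := h.arr_eq hj
  rw [vtx_next hi] at e2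
  have hn := h.1
  unfold loadProg
  simp only [Prog.run, run_nextProg, h4, hn]
  generalize (if i + 1 < L.length then i + 1 else 0) = j at *
  -- Evaluates `2 * 2` and `2 * 2 + 1` to the array names 4 and 5 that the program reads.
  norm_num at e1 e2
  refine ⟨⟨rfl, fun x hx => by simp [State.setReal, State.setInt, hx]⟩, ?_⟩
  simp [State.setReal, State.setInt, RExpr.eval, IExpr.eval, orientExpr, crossExpr, h0, h1, h2, h3,
    h4, e1, e2, planeOrient, crossPoint]

/-- Append the surviving points of an edge of the list in slot `2` to slot `3`. -/
def emitProg : Prog :=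
  .seq (.branch (.not (.realLt (.var 8) (.const 0))) (pushProg 3 4 5) .skip)
  (.seq (.branch (.and (.realLt (.mul (.var 8) (.var 9)) (.const 0))
      (.not (.and (.not (.intLt (.add (.var 4) (.const 1)) (.var 2)))
        (.not (.intLt (.const 2) (.var 2))))))
    (pushProg 3 10 11) .skip)
  (incr 4))

-- The second test comes after a possible push to slot 3, but reads nothing that this push changes,
-- so both tests can be decided in the initial state.
open Classical in
theorem run_emitProg (σ : State) :
    emitProg.run σ = (incr 4).run
      (if σ.real 8 * σ.real 9 < 0 ∧ (σ.int 4 + 1 < σ.int 2 ∨ 2 < σ.int 2) then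
        (if 0 ≤ σ.real 8 then σ.push 3 (σ.real 4, σ.real 5) else σ).push 3
          (σ.real 10, σ.real 11)
      else if 0 ≤ σ.real 8 then σ.push 3 (σ.real 4, σ.real 5) else σ) := by
  unfold emitProg
  simp only [Prog.run, run_pushProg, Test.Holds, RExpr.eval, IExpr.eval, not_lt, not_and_or,
    Rat.cast_zero, not_le]
  by_cases h : 0 ≤ σ.real 8 <;>
    simp [h, State.push, State.setInt, State.write]

/-- Clip the list in slot `2` by the half-plane given by the real variables `0` to `3`;
the result is stored in slot `3`. -/
def clipProg : Prog :=
  .seq (.seq (.setInt 3 (.const 0)) (.setInt 4 (.const 0)))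
    (.loop (.intLt (.var 4) (.var 2)) (.seq loadProg emitProg))

/-- A time bound for clipping a list of length `N`. -/
def clipCost (N : ℕ) : ℕ :=
  (Prog.seq (.setInt 3 (.const 0)) (.setInt 4 (.const 0))).maxCost +
    (N * ((Test.intLt (.var 4) (.var 2)).cost + (Prog.seq loadProg emitProg).maxCost) +
      (Test.intLt (.var 4) (.var 2)).cost)

theorem clipCost_mono {M N : ℕ} (h : M ≤ N) : clipCost M ≤ clipCost N := by
  unfold clipCost
  gcongr

/-- The real variables `0` to `3` hold the coordinates of `a` and `b`. -/
def HoldsLine (σ : State) (a b : ℝ × ℝ) : Prop :=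
  σ.real 0 = a.1 ∧ σ.real 1 = a.2 ∧ σ.real 2 = b.1 ∧ σ.real 3 = b.2

theorem runs_clipProg {σ : State} {L : List (ℝ × ℝ)} (h : Stores σ 2 L) {a b : ℝ × ℝ}
    (hab : HoldsLine σ a b) :
    Runs clipProg σ (clipCost L.length) (fun τ => Stores τ 3 (clip a b L) ∧ AgreeOff 3 σ τ) := by
  have hinit : Prog.LoopFree (.seq (.setInt 3 (.const 0)) (.setInt 4 (.const 0))) :=
    ⟨trivial, trivial⟩
  have hbody : (Prog.seq loadProg emitProg).LoopFree := by
    simp [loadProg, emitProg, nextProg, pushProg, incr, Prog.LoopFree]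
  refine (hinit.runs (Q := fun τ => Stores τ 3 [] ∧ AgreeOff 3 σ τ ∧ τ.int 4 = 0 ∧
    HoldsLine τ a b) ?_).seq fun τ hτ => ?_
  · refine ⟨Stores.nil ?_, ?_, ?_, hab⟩
    · simp [Prog.run, State.setInt, IExpr.eval]
    · exact ((AgreeOff.refl 3 σ).setInt (Or.inl rfl) _).setInt (Or.inr (Or.inl rfl)) _
    · simp [Prog.run, State.setInt, IExpr.eval]
  -- After `k` edges, slot 3 holds the survivors among the first `2 * k` boundary positions.
  · refine (Runs.loop (N := L.length) (fun k τ => Stores τ 3 (clipPrefix a b L (2 * k)) ∧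
      AgreeOff 3 σ τ ∧ τ.int 4 = k ∧ HoldsLine τ a b) ?_ ?_ (σ := τ) ?_).mono le_rfl ?_
    · rintro k hk υ ⟨h1, h2, h3, h4⟩
      have hs := h.of_agreeOff h2 (by norm_num) (by norm_num) (by norm_num)
      refine ⟨by simpa [Test.Holds, IExpr.eval, h3, hs.1] using hk, hbody.runs ?_⟩
      obtain ⟨⟨l1, l2⟩, l3, l4, l5, l6, l7⟩ := run_loadProg hs hk h3 h4.1 h4.2.1 h4.2.2.1 h4.2.2.2
      rw [show (Prog.seq loadProg emitProg).run υ = emitProg.run (loadProg.run υ) from rfl]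
      have l8 : AgreeOff 3 υ (loadProg.run υ) := ⟨fun x _ _ h6 => l2 x h6, fun _ _ _ => by rw [l1]⟩
      have l9 := h1.of_eq (l2 3 (by norm_num)) l1
      have l10 := (l2 4 (by norm_num)).trans h3
      have l11 := (l2 2 (by norm_num)).trans hs.1
      have l12 := h2.trans l8
      generalize loadProg.run υ = ρ at *
      rw [run_emitProg, l4, l5, l6, l7, l10, l11, clipPrefix_succ]
      have hpush : ∀ (π : State) (p : ℝ × ℝ), (π.push 3 p).int 4 = π.int 4 := fun π p => by
        simp [State.push, State.setInt, State.write]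
      have hfin : ∀ (M : List (ℝ × ℝ)) (π : State), Stores π 3 M → AgreeOff 3 σ π →
          π.int 4 = k → HoldsLine π a b → Stores ((incr 4).run π) 3 M ∧
          AgreeOff 3 σ ((incr 4).run π) ∧ ((incr 4).run π).int 4 = k + 1 ∧
          HoldsLine ((incr 4).run π) a b := by
        intro M π m1 m2 m3 m4
        exact ⟨m1.of_eq (by simp [incr, Prog.run, State.setInt]) rfl,
          m2.setInt (Or.inr (Or.inl rfl)) _,
          by simp [incr, Prog.run, State.setInt, IExpr.eval, m3], m4⟩
      apply hfin
      · split_ifs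
        · exact (l9.push _).push _
        · simpa using l9.push _
        · simpa using l9.push _
        · simpa using l9
      · split_ifs
        · exact (l12.push _).push _
        · exact l12.push _
        · exact l12.push _
        · exact l12
      · split_ifs <;> simp only [hpush, l10]
      · split_ifs <;> exact l3
    · rintro υ ⟨-, h2, h3, -⟩
      have hs := h.of_agreeOff h2 (by norm_num) (by norm_num) (by norm_num)
      simp [Test.Holds, IExpr.eval, h3, hs.1]
    · simpa using hτ
    · rintro υ ⟨h1, h2, -⟩
      exact ⟨h1, h2⟩

/-- Load the edge of the list in slot `1` whose index is the integer variable `5`. -/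
def edgeProg : Prog :=
  .seq (nextProg 5 1)
  (.seq (.setReal 0 (.read 2 (.var 5)))
  (.seq (.setReal 1 (.read 3 (.var 5)))
  (.seq (.setReal 2 (.read 2 (.var 6)))
  (.setReal 3 (.read 3 (.var 6))))))

theorem run_edgeProg {σ : State} {B : List (ℝ × ℝ)} (h : Stores σ 1 B) {i : ℕ}
    (hi : i < B.length) (h5 : σ.int 5 = i) :
    HoldsLine (edgeProg.run σ) (vtx B i) (vtx B (i + 1)) ∧ (edgeProg.run σ).arr = σ.arr ∧
      ∀ x, x ≠ 6 → (edgeProg.run σ).int x = σ.int x := by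
  have hj : (if i + 1 < B.length then i + 1 else 0) < B.length := by split_ifs <;> omega
  have e1 := h.arr_eq hi
  have e2 := h.arr_eq hj
  rw [vtx_next hi] at e2
  have hn := h.1
  unfold edgeProg HoldsLine
  simp only [Prog.run, run_nextProg, h5, hn]
  generalize (if i + 1 < B.length then i + 1 else 0) = j at *
  norm_num at e1 e2
  refine ⟨?_, rfl, fun x hx => by simp [State.setReal, State.setInt, hx]⟩
  simp [State.setReal, State.setInt, RExpr.eval, IExpr.eval, h5, e1, e2]

/-- Intersect the polygons in slots `0` and `1`; the result is stored in slot `2`. -/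
def intersectProg : Prog :=
  .seq (copyProg 0 2)
  (.seq (.setInt 5 (.const 0))
  (.loop (.intLt (.var 5) (.var 1))
    (.seq edgeProg (.seq clipProg (.seq (copyProg 3 2) (incr 5))))))

/-- A time bound for clipping a list of length at most `N` by one edge. -/
def edgeStepCost (N : ℕ) : ℕ :=
  edgeProg.maxCost + (clipCost N + (copyCost 3 2 (2 * N) + (incr 5).maxCost))

theorem runs_edgeStep {σ : State} {B L : List (ℝ × ℝ)} {i : ℕ} (hB : Stores σ 1 B)
    (hL : Stores σ 2 L) (hi : i < B.length) (h5 : σ.int 5 = i) {N : ℕ} (hN : L.length ≤ N) :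
    Runs (.seq edgeProg (.seq clipProg (.seq (copyProg 3 2) (incr 5)))) σ (edgeStepCost N)
      (fun τ => Stores τ 1 B ∧ Stores τ 2 (clip (vtx B i) (vtx B (i + 1)) L) ∧
        τ.int 5 = i + 1) := by
  have hedge : edgeProg.LoopFree := by simp [edgeProg, nextProg, Prog.LoopFree]
  have hincr : (incr 5).LoopFree := trivial
  refine (hedge.runs (Q := fun τ => Stores τ 1 B ∧ Stores τ 2 L ∧ τ.int 5 = i ∧
    HoldsLine τ (vtx B i) (vtx B (i + 1))) ?_).seq ?_
  · obtain ⟨e1, e2, e3⟩ := run_edgeProg hB hi h5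
    exact ⟨hB.of_eq (e3 1 (by norm_num)) e2, hL.of_eq (e3 2 (by norm_num)) e2,
      (e3 5 (by norm_num)).trans h5, e1⟩
  rintro τ ⟨t1, t2, t3, t4⟩
  refine ((runs_clipProg t2 t4).mono (clipCost_mono hN) fun _ h => h).seq ?_
  rintro υ ⟨u1, u2⟩
  refine ((runs_copyProg (q := 3) (q' := 2) (by norm_num) (by norm_num) (by norm_num)
    (by norm_num) u1).mono (copyCost_mono 3 2 (clip_length_le.trans (by omega)))
    fun _ h => h).seq ?_
  rintro ρ ⟨r1, r2⟩
  have hρ := (t1.of_agreeOff u2 (by norm_num) (by norm_num) (by norm_num)).of_agreeOff r2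
    (by norm_num) (by norm_num) (by norm_num)
  have hρ5 : ρ.int 5 = i := by
    rw [r2.1 5 (by norm_num) (by norm_num) (by norm_num),
      u2.1 5 (by norm_num) (by norm_num) (by norm_num), t3]
  refine hincr.runs ⟨hρ.of_eq ?_ rfl, r1.of_eq ?_ rfl, ?_⟩ <;>
    simp [incr, Prog.run, State.setInt, IExpr.eval, hρ5]

/-- A time bound for the intersection, if the lists have length at most `M` and `N`. -/
def intersectCost (M N : ℕ) : ℕ :=
  copyCost 0 2 M + ((Prog.setInt 5 (.const 0)).maxCost +
    (N * ((Test.intLt (.var 5) (.var 1)).cost + edgeStepCost (2 ^ N * M)) +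
      (Test.intLt (.var 5) (.var 1)).cost))

theorem runs_intersectProg {σ : State} {A B : List (ℝ × ℝ)} (hA : Stores σ 0 A)
    (hB : Stores σ 1 B) {M N : ℕ} (hM : A.length ≤ M) (hN : B.length ≤ N) :
    Runs intersectProg σ (intersectCost M N)
      (fun τ => Stores τ 2 (clipEdges B A B.length)) := by
  have hset : (Prog.setInt 5 (.const 0)).LoopFree := trivial
  refine ((runs_copyProg (q := 0) (q' := 2) (by norm_num) (by norm_num) (by norm_num)
    (by norm_num) hA).mono (copyCost_mono 0 2 hM) fun _ h => h).seq ?_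
  rintro τ ⟨t1, t2⟩
  have hτ := hB.of_agreeOff t2 (by norm_num) (by norm_num) (by norm_num)
  refine (hset.runs (Q := fun υ => Stores υ 1 B ∧ Stores υ 2 A ∧ υ.int 5 = 0) ?_).seq ?_
  · refine ⟨hτ.of_eq ?_ rfl, t1.of_eq ?_ rfl, ?_⟩ <;>
      simp [Prog.run, State.setInt, IExpr.eval]
  intro υ hυ
  refine (Runs.loop (N := B.length) (c := edgeStepCost (2 ^ N * M)) (fun k υ => Stores υ 1 B ∧
    Stores υ 2 (clipEdges B A k) ∧ υ.int 5 = k) ?_ ?_ (σ := υ) hυ).mono (by gcongr) ?_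
  · rintro k hk ρ ⟨r1, r2, r3⟩
    refine ⟨by simpa [Test.Holds, IExpr.eval, r3, r1.1] using hk,
      runs_edgeStep r1 r2 hk r3 ((clipEdges_length_le B A k).trans ?_)⟩
    -- The worst length, after at most `N` doublings, is charged to every pass.
    exact Nat.mul_le_mul (Nat.pow_le_pow_right two_pos (hk.le.trans hN)) hM
  · rintro ρ ⟨r1, -, r3⟩
    simp [Test.Holds, IExpr.eval, r3, r1.1]
  · exact fun ρ h => h.2.1

end RealRAM

theorem mainTheorem9 :
    ∃ prog : RealRAM.Prog, ∀ m : ℕ, 3 ≤ m → ∃ C : ℕ,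
      ∀ (n : ℕ) (P : ℕ → DataPoint), IsTrajectory n P →
      ∀ s k : ℕ, s + k ≤ n →
      ∀ ε : ℝ, 0 < ε → ∀ tc : ℝ, (P s).t < tc →
      ∀ l : ℕ, 1 ≤ l → l < k →
      ∀ A B : List (ℝ × ℝ),
        IsVertexList A (inscribedIntersection m P s ε tc l) →
        IsVertexList B (inscribedPolygon m P s ε tc (l + 1)) →
      ∀ σ : RealRAM.State, RealRAM.Stores σ 0 A → RealRAM.Stores σ 1 B →
        ∃ (t : ℕ) (τ : RealRAM.State) (L : List (ℝ × ℝ)),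
          t ≤ C ∧ RealRAM.Exec prog σ t τ ∧ RealRAM.Stores τ 2 L ∧
          IsVertexList L
            (inscribedIntersection m P s ε tc l ∩ inscribedPolygon m P s ε tc (l + 1)) := by
  -- The program is fixed before `m`. The bounds `2 ^ m` and `m` are those for the lengths of `A`
  -- and `B`.
  refine ⟨RealRAM.intersectProg, fun m hm => ⟨RealRAM.intersectCost (2 ^ m) m, ?_⟩⟩
  intro n P hP s k hk ε hε tc htc l _ hlk A B hA hB σ sA sB
  have h3 := regularPolygon_three_le hm
    (coneRadius_pos hP (i := l + 1) (by omega) (by omega) hε htc) hB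
  have hM := inscribedIntersection_length_le hm hP (by omega) hε htc hA hB
  obtain ⟨t, τ, ht, e, hτ⟩ :=
    RealRAM.runs_intersectProg sA sB hM (regularPolygon_length_le hB)
  exact ⟨t, τ, _, ht, e, hτ, hA.inter hB h3⟩
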